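/- Let $N\ge 1$, let $A=(A_{ij})_{1\le i,j\le N}$ be a non-random self-adjoint complex matrix with $|A_{ij}|\le a$ for all $i,j$, and let $\omega=(\omega_{ij})_{1\le i,j\le N}$ be complex random variables on a probability space $(\Omega,\mathbb P)$ with $\omega_{ij}=\overline{\omega_{ji}}$, such that $\{\omega_{ij}: i\le j\}$ are independent and, for $i\le j$, $\omega_{ij}$ has the law $P_{ij}$ of $u+\sqrt{-1}\,v$, where $u,v$ are independent real random variables with laws $P^R_{ij}$, $P^I_{ij}$. Let $\mathbf X_A(\omega)$ be the self-adjoint $N\times N$ matrix with entries $N^{-1/2}A_{ij}\omega_{ij}$. Write $\mathrm{tr}(M)=N^{-1}\sum_i M_{ii}$ and, for Lipschitz $f:\mathbb R\to\mathbb R$, $|f|_{\mathcal L}=\sup_{x\ne y}|f(x)-f(y)|/|x-y|$; $f(\mathbf X_A)$ is defined by functional calculus. (a) Let $K\subset\mathbb C$ be a compact set, of diameter $|K|$, with $P_{ij}(K^c)=0$ for all $1\le i\le j\le N$, and let $f$ be convex and Lipschitz. Then $\mathrm{tr} f(\mathbf X_A)$ is integrable and, with $\delta_0(N)=8|K|\sqrt{\pi}\,a|f|_{\mathcal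 L}/N$, for every $\delta>\delta_0(N)$, $$\mathbb P\big(|\mathrm{tr} f(\mathbf X_A)-\mathbb E[\mathrm{tr} f(\mathbf X_A)]|\ge\delta\big)\le 4\exp\Big(-\frac{1}{16|K|^2a^2|f|_{\mathcal L}^2}N^2(\delta-\delta_0(N))^2\Big).$$ (b) Suppose that for some $c$ all the laws $P^R_{ij}$, $P^I_{ij}$, $1\le i\le j\le N$, satisfy the logarithmic Sobolev inequality with constant $c$, that is, $\int g^2\log\big(g^2/\int g^2d\nu\big)d\nu\le 2c\int |g'|^2d\nu$ for every bounded $C^1$ function $g:\mathbb R\to\mathbb R$ with bounded derivative. Then, for every Lipschitz $f$, $\mathrm{tr} f(\mathbf X_A)$ is integrable and, for every $\delta>0$, $$\mathbb P\big(|\mathrm{tr} f(\mathbf X_A)-\mathbb E[\mathrm{tr} f(\mathbf X_A)]|\ge\delta\big)\le 2\exp\Big(-\frac{1}{8ca^2|f|_{\mathcal L}^2}N^2\delta^2\Big).$$ In the degenerate cases where a denominator vanishes, $1/0$ is read as $0$ and the bound is void. -/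

import Mathlib

open MeasureTheory ProbabilityTheory

noncomputable section

namespace MatrixConcentration

/-- The Lipschitz constant `sup_{x ≠ y} |f x - f y| / |x - y|` of a function on the real line. It is
used only for Lipschitz `f`, where the supremum is finite. -/
def lipConst (f : ℝ → ℝ) : ℝ :=
  ⨆ p : {p : ℝ × ℝ // p.1 ≠ p.2}, |f p.1.1 - f p.1.2| / |p.1.1 - p.1.2|

/-- The measure `ν` on the real line satisfies the logarithmic Sobolev inequality with constant `c`:
`∫ g² log (g² / ∫ g² dν) dν ≤ 2 c ∫ |g'|² dν`. The test functions are the bounded `C¹` functions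
with bounded derivative, so that for a finite measure all the integrals converge. -/
def LogSobolev (ν : Measure ℝ) (c : ℝ) : Prop :=
  ∀ g : ℝ → ℝ, ContDiff ℝ 1 g → (∃ M : ℝ, ∀ x, |g x| ≤ M) → (∃ M : ℝ, ∀ x, |deriv g x| ≤ M) →
    ∫ x, g x ^ 2 * Real.log (g x ^ 2 / ∫ y, g y ^ 2 ∂ν) ∂ν ≤ 2 * c * ∫ x, deriv g x ^ 2 ∂ν

/-- The law on `ℂ` of `u + i v`, where `u` has law `μR`, `v` has law `μI`, and `u`, `v` are
independent. -/
def entryLaw (μR μI : Measure ℝ) : Measure ℂ :=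
  (μR.prod μI).map fun q : ℝ × ℝ => (q.1 : ℂ) + Complex.I * (q.2 : ℂ)

/-- The matrix with entries `A i j * w i j / √N`. -/
def weightedMatrix {N : ℕ} (A : Matrix (Fin N) (Fin N) ℂ) (w : Fin N → Fin N → ℂ) :
    Matrix (Fin N) (Fin N) ℂ :=
  Matrix.of fun i j => ((1 / Real.sqrt N : ℝ) : ℂ) * A i j * w i j

/-- The normalized trace `N⁻¹ ∑ i, M i i`. -/
def normTrace {N : ℕ} (M : Matrix (Fin N) (Fin N) ℂ) : ℂ :=
  (N : ℂ)⁻¹ * M.trace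

/-- The normalized trace of `f (X)`, where `X` has entries `A i j * w i j / √N` and `f (X)` is given
by the functional calculus of self-adjoint matrices. -/
def spectralStat {N : ℕ} (f : ℝ → ℝ) (A : Matrix (Fin N) (Fin N) ℂ) (w : Fin N → Fin N → ℂ) : ℂ :=
  normTrace (cfc f (weightedMatrix A w))

/-- The weighted matrix is self-adjoint as soon as `A` and `w` are. -/
theorem weightedMatrix_isHermitian {N : ℕ} {A : Matrix (Fin N) (Fin N) ℂ}
    {w : Fin N → Fin N → ℂ} (hA : A.IsHermitian)
    (hw : ∀ i j, w i j = (starRingEnd ℂ) (w j i)) : (weightedMatrix A w).IsHermitian := by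
  ext i j
  have h1 := hA.apply i j
  simp only [RCLike.star_def] at h1
  simp only [Matrix.conjTranspose_apply, weightedMatrix, Matrix.of_apply, RCLike.star_def, map_mul,
    Complex.conj_ofReal, h1, ← hw i j]

end MatrixConcentration

end

/-!
Write the spectral statistic as a real function of the independent entries on and above the
diagonal, viewed in a finite-dimensional Hilbert space. The squared overlaps of the eigenbases of
two Hermitian matrices form a doubly stochastic matrix. Read as a coupling of the two spectra, it
shows that the statistic is Lipschitz with constant `√2 a |f| / N` (Hoffman–Wielandt); read as an
averaging of the eigenvalues, it shows by Jensen that the statistic is convex when `f` is (Peierls,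
Klein).

For bounded entries and convex `f`, Maurey's convex property `(τ)` holds for each entry, tensorizes,
and bounds the Laplace transform of convex Lipschitz functions. For log-Sobolev entries, the
inequality in its exponential form tensorizes by subadditivity of entropy, and the Herbst argument
bounds the Laplace transform of smooth bounded Lipschitz functions; a mollification and a truncation
remove these restrictions. In both cases the statistic is sub-Gaussian around its mean and the tail
bound is Chernoff's. The shift `δ₀`, the price of passing from a median to the mean, does not arise.
-/

universe u

namespace MatrixConcentration

open Real Filter Topology Matrix

/-! ### Spectral sums of Hermitian matrices -/

section SpectralSum

variable {n : Type*} [Fintype n] [DecidableEq n]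

theorem trace_cfc_eq_sum_eigenvalues (f : ℝ → ℝ) {X : Matrix n n ℂ} (hX : X.IsHermitian) :
    (cfc f X).trace = ((∑ i, f (hX.eigenvalues i) : ℝ) : ℂ) := by
  rw [hX.cfc_eq, Matrix.IsHermitian.cfc, Unitary.conjStarAlgAut_apply, trace_mul_cycle,
    Unitary.coe_star_mul_self, one_mul, trace_diagonal]
  simp

theorem re_trace_cfc_eq_sum_eigenvalues (f : ℝ → ℝ) {X : Matrix n n ℂ} (hX : X.IsHermitian) :
    (cfc f X).trace.re = ∑ i, f (hX.eigenvalues i) := by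
  rw [trace_cfc_eq_sum_eigenvalues f hX, Complex.ofReal_re]

omit [DecidableEq n] in
theorem ofReal_sum_norm_sq_eq_trace (M : Matrix n n ℂ) :
    ((∑ i, ∑ j, ‖M i j‖ ^ 2 : ℝ) : ℂ) = (M * star M).trace := by
  simp [Matrix.trace, Matrix.mul_apply, Complex.mul_conj']

theorem sum_norm_sq_unitary_mul_mul (U V : unitaryGroup n ℂ) (M : Matrix n n ℂ) :
    ∑ i, ∑ j, ‖((U : Matrix n n ℂ) * M * (V : Matrix n n ℂ)) i j‖ ^ 2 =
      ∑ i, ∑ j, ‖M i j‖ ^ 2 := by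
  have h : ((U : Matrix n n ℂ) * M * V) * star ((U : Matrix n n ℂ) * M * V) =
      U * (M * star M) * star (U : Matrix n n ℂ) := by
    calc _ = (U : Matrix n n ℂ) * M * (V * star (V : Matrix n n ℂ)) * star M * star U.1 := by
          simp only [star_mul, mul_assoc]
      _ = _ := by rw [mem_unitaryGroup_iff.1 V.2]; simp only [mul_assoc, mul_one]
  apply Complex.ofReal_injective
  rw [ofReal_sum_norm_sq_eq_trace, ofReal_sum_norm_sq_eq_trace, h, trace_mul_cycle,
    mem_unitaryGroup_iff'.1 U.2, one_mul]

theorem norm_sq_unitary_mem_doublyStochastic (U : unitaryGroup n ℂ) :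
    (of fun i j => ‖(U : Matrix n n ℂ) i j‖ ^ 2) ∈ doublyStochastic ℝ n := by
  refine mem_doublyStochastic_iff_sum.2 ⟨fun i j => sq_nonneg _, fun i => ?_, fun j => ?_⟩
  · have h := congrFun (congrFun (mem_unitaryGroup_iff.1 U.2) i) i
    simp only [mul_apply, star_apply, RCLike.star_def, Complex.mul_conj', one_apply_eq] at h
    exact_mod_cast h
  · have h := congrFun (congrFun (mem_unitaryGroup_iff'.1 U.2) j) j
    simp only [mul_apply, star_apply, RCLike.star_def, Complex.conj_mul', one_apply_eq] at h
    exact_mod_cast h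

variable {X Y : Matrix n n ℂ}

/-- The unitary matrix passing from an orthonormal eigenbasis of `Y` to one of `X`. -/
noncomputable def eigenbasisChange (hX : X.IsHermitian) (hY : Y.IsHermitian) : unitaryGroup n ℂ :=
  star hX.eigenvectorUnitary * hY.eigenvectorUnitary

/-- The squared overlaps `|⟨xᵢ, yⱼ⟩|²` between the eigenvectors of two Hermitian matrices;
it couples the two spectra. -/
noncomputable def overlap (hX : X.IsHermitian) (hY : Y.IsHermitian) : n → n → ℝ := fun i j =>
  ‖(eigenbasisChange hX hY : Matrix n n ℂ) i j‖ ^ 2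

theorem overlap_nonneg (hX : X.IsHermitian) (hY : Y.IsHermitian) (i j : n) :
    0 ≤ overlap hX hY i j := sq_nonneg _

theorem sum_overlap_row (hX : X.IsHermitian) (hY : Y.IsHermitian) (i : n) :
    ∑ j, overlap hX hY i j = 1 :=
  (mem_doublyStochastic_iff_sum.1 (norm_sq_unitary_mem_doublyStochastic _)).2.1 i

theorem sum_overlap_col (hX : X.IsHermitian) (hY : Y.IsHermitian) (j : n) :
    ∑ i, overlap hX hY i j = 1 :=
  (mem_doublyStochastic_iff_sum.1 (norm_sq_unitary_mem_doublyStochastic _)).2.2 j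

theorem sum_sum_overlap_mul_left (hX : X.IsHermitian) (hY : Y.IsHermitian) (g : n → ℝ) :
    ∑ i, ∑ j, overlap hX hY i j * g i = ∑ i, g i := by
  simp only [← Finset.sum_mul, sum_overlap_row, one_mul]

theorem sum_sum_overlap_mul_right (hX : X.IsHermitian) (hY : Y.IsHermitian) (g : n → ℝ) :
    ∑ i, ∑ j, overlap hX hY i j * g j = ∑ j, g j := by
  rw [Finset.sum_comm]
  simp only [← Finset.sum_mul, sum_overlap_col, one_mul]

theorem star_eigenvectorUnitary_mul_mul (hX : X.IsHermitian) :
    (star hX.eigenvectorUnitary : Matrix n n ℂ) * X * hX.eigenvectorUnitary =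
      diagonal fun i => (hX.eigenvalues i : ℂ) := by
  have h := hX.conjStarAlgAut_star_eigenvectorUnitary
  rwa [Unitary.conjStarAlgAut_apply, Unitary.coe_star, star_star] at h

theorem conj_eigenvectorUnitary_diag (hX : X.IsHermitian) (hY : Y.IsHermitian) (i : n) :
    ((star hX.eigenvectorUnitary : Matrix n n ℂ) * Y * hX.eigenvectorUnitary) i i =
      ((∑ j, overlap hX hY i j * hY.eigenvalues j : ℝ) : ℂ) := by
  set W : Matrix n n ℂ := (eigenbasisChange hX hY).1 with hW
  have hY_conj : (star hX.eigenvectorUnitary : Matrix n n ℂ) * Y * hX.eigenvectorUnitary =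
      W * diagonal (fun j => (hY.eigenvalues j : ℂ)) * star W := by
    rw [← star_eigenvectorUnitary_mul_mul hY]
    calc _ = star hX.eigenvectorUnitary.1 *
            (hY.eigenvectorUnitary.1 * star hY.eigenvectorUnitary.1) * Y *
            (hY.eigenvectorUnitary.1 * star hY.eigenvectorUnitary.1) * hX.eigenvectorUnitary.1 := by
          simp only [mem_unitaryGroup_iff.1 hY.eigenvectorUnitary.2, mul_one]
      _ = _ := by
          simp only [hW, eigenbasisChange, Submonoid.coe_mul, Unitary.coe_star, star_mul, star_star,
            mul_assoc]
  rw [hY_conj, mul_apply, Complex.ofReal_sum]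
  refine Finset.sum_congr rfl fun j _ => ?_
  have hWj : ((overlap hX hY i j : ℝ) : ℂ) = W i j * star (W i j) := by
    rw [RCLike.star_def, Complex.mul_conj', overlap, Complex.ofReal_pow]
  rw [mul_diagonal, star_apply, Complex.ofReal_mul, hWj]
  ring

theorem eigenvectorUnitary_mul_sub_mul_apply (hX : X.IsHermitian) (hY : Y.IsHermitian) (i j : n) :
    ((star hX.eigenvectorUnitary : Matrix n n ℂ) * (X - Y) * hY.eigenvectorUnitary) i j =
      (eigenbasisChange hX hY : Matrix n n ℂ) i j *
        ((hX.eigenvalues i - hY.eigenvalues j : ℝ) : ℂ) := by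
  set U : Matrix n n ℂ := hX.eigenvectorUnitary.1
  set V : Matrix n n ℂ := hY.eigenvectorUnitary.1
  have hUU : U * star U = 1 := mem_unitaryGroup_iff.1 hX.eigenvectorUnitary.2
  have hVV : V * star V = 1 := mem_unitaryGroup_iff.1 hY.eigenvectorUnitary.2
  have hUX : star U * X = diagonal (fun i => (hX.eigenvalues i : ℂ)) * star U := by
    rw [← star_eigenvectorUnitary_mul_mul hX, mul_assoc, hUU, mul_one]
  have hYV : Y * V = V * diagonal (fun j => (hY.eigenvalues j : ℂ)) := by
    rw [← star_eigenvectorUnitary_mul_mul hY, ← mul_assoc, ← mul_assoc, hVV, one_mul]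
  have hW : (eigenbasisChange hX hY : Matrix n n ℂ) = star U * V := rfl
  rw [mul_sub, sub_mul, hUX, mul_assoc (star U) Y, hYV, mul_assoc, ← mul_assoc (star U), hW,
    Matrix.sub_apply, diagonal_mul, mul_diagonal]
  simp only [Complex.ofReal_sub]
  ring

theorem sum_overlap_mul_sq_sub (hX : X.IsHermitian) (hY : Y.IsHermitian) :
    ∑ i, ∑ j, overlap hX hY i j * (hX.eigenvalues i - hY.eigenvalues j) ^ 2 =
      ∑ i, ∑ j, ‖(X - Y) i j‖ ^ 2 := by
  rw [← sum_norm_sq_unitary_mul_mul (star hX.eigenvectorUnitary) hY.eigenvectorUnitary (X - Y)]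
  refine Finset.sum_congr rfl fun i _ => Finset.sum_congr rfl fun j _ => ?_
  rw [Unitary.coe_star, eigenvectorUnitary_mul_sub_mul_apply, norm_mul, mul_pow, Complex.norm_real,
    Real.norm_eq_abs, sq_abs, overlap]

theorem abs_re_trace_cfc_sub_le (hX : X.IsHermitian) (hY : Y.IsHermitian) {f : ℝ → ℝ} {L : NNReal}
    (hf : LipschitzWith L f) :
    |(cfc f X).trace.re - (cfc f Y).trace.re| ≤
      L * √(Fintype.card n) * √(∑ i, ∑ j, ‖(X - Y) i j‖ ^ 2) := by
  set P := overlap hX hY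
  set d : n → n → ℝ := fun i j => hX.eigenvalues i - hY.eigenvalues j
  have hcard : ∑ i, ∑ j, P i j = Fintype.card n := by simp [P, sum_overlap_row]
  have hCS : (∑ i, ∑ j, P i j * |d i j|) ^ 2 ≤
      Fintype.card n * ∑ i, ∑ j, ‖(X - Y) i j‖ ^ 2 := by
    rw [← hcard, ← sum_overlap_mul_sq_sub hX hY]
    rw [← Fintype.sum_prod_type', ← Fintype.sum_prod_type', ← Fintype.sum_prod_type']
    refine Finset.sum_sq_le_sum_mul_sum_of_sq_le_mul _
      (fun p _ => overlap_nonneg hX hY p.1 p.2)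
      (fun p _ => mul_nonneg (overlap_nonneg hX hY p.1 p.2) (sq_nonneg _)) fun p _ => ?_
    rw [mul_pow, sq_abs, sq (P _ _), mul_assoc]
  rw [re_trace_cfc_eq_sum_eigenvalues f hX, re_trace_cfc_eq_sum_eigenvalues f hY,
    ← sum_sum_overlap_mul_left hX hY, ← sum_sum_overlap_mul_right hX hY fun j => f _]
  simp only [← Finset.sum_sub_distrib, ← mul_sub]
  calc |∑ i, ∑ j, P i j * (f (hX.eigenvalues i) - f (hY.eigenvalues j))|
      ≤ ∑ i, ∑ j, P i j * (L * |d i j|) := by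
        refine (Finset.abs_sum_le_sum_abs _ _).trans (Finset.sum_le_sum fun i _ => ?_)
        refine (Finset.abs_sum_le_sum_abs _ _).trans (Finset.sum_le_sum fun j _ => ?_)
        rw [abs_mul, abs_of_nonneg (overlap_nonneg hX hY i j)]
        exact mul_le_mul_of_nonneg_left (hf.dist_le_mul _ _) (overlap_nonneg hX hY i j)
    _ = L * ∑ i, ∑ j, P i j * |d i j| := by simp only [Finset.mul_sum, mul_left_comm]
    _ ≤ L * (√(Fintype.card n) * √(∑ i, ∑ j, ‖(X - Y) i j‖ ^ 2)) := by
        rw [← Real.sqrt_mul (Nat.cast_nonneg _)]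
        exact mul_le_mul_of_nonneg_left (Real.le_sqrt_of_sq_le hCS) L.2
    _ = _ := (mul_assoc _ _ _).symm

theorem sum_map_sum_overlap_mul_le (hX : X.IsHermitian) (hY : Y.IsHermitian) {f : ℝ → ℝ}
    (hf : ConvexOn ℝ Set.univ f) :
    ∑ i, f (∑ j, overlap hX hY i j * hY.eigenvalues j) ≤ ∑ j, f (hY.eigenvalues j) := by
  rw [← sum_sum_overlap_mul_right hX hY fun j => f (hY.eigenvalues j)]
  exact Finset.sum_le_sum fun i _ => hf.map_sum_le (fun j _ => overlap_nonneg hX hY i j)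
    (sum_overlap_row hX hY i) fun _ _ => Set.mem_univ _

theorem eigenvalues_eq_of_eq_smul_add_smul {Z : Matrix n n ℂ} (hX : X.IsHermitian)
    (hY : Y.IsHermitian) (hZ : Z.IsHermitian) {s t : ℝ} (h : Z = s • X + t • Y) (i : n) :
    hZ.eigenvalues i = s * ∑ j, overlap hZ hX i j * hX.eigenvalues j +
      t * ∑ j, overlap hZ hY i j * hY.eigenvalues j := by
  have hdiag := congrFun (congrFun (star_eigenvectorUnitary_mul_mul hZ) i) i
  have hZ' : (star hZ.eigenvectorUnitary : Matrix n n ℂ) * Z * hZ.eigenvectorUnitary =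
      s • ((star hZ.eigenvectorUnitary : Matrix n n ℂ) * X * hZ.eigenvectorUnitary) +
        t • ((star hZ.eigenvectorUnitary : Matrix n n ℂ) * Y * hZ.eigenvectorUnitary) := by
    conv_lhs => enter [1, 2]; rw [h]
    simp only [mul_add, add_mul, mul_smul_comm, smul_mul_assoc]
  rw [hZ', Matrix.add_apply, Matrix.smul_apply, Matrix.smul_apply,
    conj_eigenvectorUnitary_diag hZ hX, conj_eigenvectorUnitary_diag hZ hY,
    diagonal_apply_eq] at hdiag
  simp only [Complex.real_smul] at hdiag
  exact_mod_cast hdiag.symm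

theorem convexOn_re_trace_cfc {f : ℝ → ℝ} (hf : ConvexOn ℝ Set.univ f) :
    ConvexOn ℝ {X : Matrix n n ℂ | X.IsHermitian} fun X => (cfc f X).trace.re := by
  have hconv : Convex ℝ {X : Matrix n n ℂ | X.IsHermitian} := fun X hX Y hY s t _ _ _ =>
    (hX.smul (IsSelfAdjoint.all s)).add (hY.smul (IsSelfAdjoint.all t))
  refine ⟨hconv, fun X hX Y hY s t hs ht hst => ?_⟩
  have hZ : (s • X + t • Y).IsHermitian := hconv hX hY hs ht hst
  simp only [re_trace_cfc_eq_sum_eigenvalues f hX, re_trace_cfc_eq_sum_eigenvalues f hY,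
    re_trace_cfc_eq_sum_eigenvalues f hZ, smul_eq_mul]
  calc ∑ i, f (hZ.eigenvalues i)
      ≤ ∑ i, (s * f (∑ j, overlap hZ hX i j * hX.eigenvalues j) +
          t * f (∑ j, overlap hZ hY i j * hY.eigenvalues j)) := by
        refine Finset.sum_le_sum fun i _ => ?_
        rw [eigenvalues_eq_of_eq_smul_add_smul hX hY hZ rfl]
        exact hf.2 (Set.mem_univ _) (Set.mem_univ _) hs ht hst
    _ ≤ _ := by
        rw [Finset.sum_add_distrib, ← Finset.mul_sum, ← Finset.mul_sum]
        exact add_le_add (mul_le_mul_of_nonneg_left (sum_map_sum_overlap_mul_le hZ hX hf) hs)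
          (mul_le_mul_of_nonneg_left (sum_map_sum_overlap_mul_le hZ hY hf) ht)

end SpectralSum

/-! ### Product measures on Hilbert sums -/

section ProductMeasure

theorem isometry_toLp_mk_left {E F : Type*} [SeminormedAddCommGroup E]
    [SeminormedAddCommGroup F] (x : E) : Isometry fun y : F => WithLp.toLp 2 (x, y) :=
  Isometry.of_dist_eq fun a b => by simp [WithLp.prod_dist_eq_of_L2]

theorem isometry_toLp_mk_right {E F : Type*} [SeminormedAddCommGroup E]
    [SeminormedAddCommGroup F] (y : F) : Isometry fun x : E => WithLp.toLp 2 (x, y) :=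
  Isometry.of_dist_eq fun a b => by simp [WithLp.prod_dist_eq_of_L2]

variable {E F ι κ : Type*} [MeasurableSpace E] [MeasurableSpace F] [Fintype ι] [Fintype κ]

/-- The product of two measures, carried by the Hilbert sum of the underlying spaces. -/
noncomputable def prodL2 (μ : Measure E) (ν : Measure F) : Measure (WithLp 2 (E × F)) :=
  (μ.prod ν).map (MeasurableEquiv.toLp 2 (E × F))

/-- The product of a finite family of measures, carried by the Hilbert sum of the underlying
spaces. -/
noncomputable def piL2 (μ : ι → Measure E) : Measure (PiLp 2 fun _ : ι => E) :=
  (Measure.pi μ).map (MeasurableEquiv.toLp 2 (ι → E))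

instance (μ : Measure E) (ν : Measure F) [IsProbabilityMeasure μ] [IsProbabilityMeasure ν] :
    IsProbabilityMeasure (prodL2 μ ν) :=
  Measure.isProbabilityMeasure_map (MeasurableEquiv.measurable _).aemeasurable

instance (μ : ι → Measure E) [∀ i, IsProbabilityMeasure (μ i)] : IsProbabilityMeasure (piL2 μ) :=
  Measure.isProbabilityMeasure_map (MeasurableEquiv.measurable _).aemeasurable

theorem integrable_prodL2 {μ : Measure E} {ν : Measure F} {f : WithLp 2 (E × F) → ℝ} :
    Integrable f (prodL2 μ ν) ↔ Integrable (fun p => f (WithLp.toLp 2 p)) (μ.prod ν) :=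
  integrable_map_equiv _ _

theorem integral_prodL2 {μ : Measure E} {ν : Measure F} (f : WithLp 2 (E × F) → ℝ) :
    ∫ z, f z ∂(prodL2 μ ν) = ∫ p, f (WithLp.toLp 2 p) ∂(μ.prod ν) :=
  integral_map_equiv _ _

variable [NormedAddCommGroup E] [NormedSpace ℝ E]

variable (E ι) in
/-- Adjoining one coordinate to a finite Hilbert sum, as a linear isometry. -/
noncomputable def optionConsL2 :
    WithLp 2 (E × PiLp 2 fun _ : ι => E) ≃ₗᵢ[ℝ] PiLp 2 fun _ : Option ι => E where
  toFun p := WithLp.toLp 2 fun o => o.elim p.fst p.snd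
  invFun x := WithLp.toLp 2 (x none, WithLp.toLp 2 fun i => x (some i))
  left_inv _ := rfl
  right_inv x := by ext (_ | i) <;> rfl
  map_add' p q := by ext (_ | i) <;> rfl
  map_smul' r p := by ext (_ | i) <;> rfl
  norm_map' p := by
    refine (sq_eq_sq₀ (norm_nonneg _) (norm_nonneg _)).1 ?_
    rw [PiLp.norm_sq_eq_of_L2, WithLp.prod_norm_sq_eq_of_L2, PiLp.norm_sq_eq_of_L2,
      Fintype.sum_option]
    rfl

variable [BorelSpace E] [SecondCountableTopology E]

theorem map_optionConsL2 (μ : Option ι → Measure E) [∀ o, IsProbabilityMeasure (μ o)] :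
    (prodL2 (μ none) (piL2 fun i => μ (some i))).map (optionConsL2 E ι) = piL2 μ := by
  let cons : E × (ι → E) → Option ι → E := fun p o => o.elim p.1 p.2
  have hcons_meas : Measurable cons := by
    refine measurable_pi_lambda _ ?_
    rintro (_ | i)
    exacts [measurable_fst, (measurable_pi_apply i).comp measurable_snd]
  have hcons : ((μ none).prod (Measure.pi fun i => μ (some i))).map cons = Measure.pi μ := by
    refine (Measure.pi_eq fun s hs => ?_).symm
    have hbox : cons ⁻¹' Set.univ.pi s = s none ×ˢ Set.univ.pi fun i => s (some i) := by
      ext p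
      simp [cons, Option.forall]
    rw [Measure.map_apply hcons_meas (.univ_pi hs), hbox, Measure.prod_prod, Measure.pi_pi,
      Fintype.prod_option]
  rw [piL2, piL2, ← hcons, prodL2]
  nth_rw 1 [← Measure.map_id (μ := μ none)]
  rw [Measure.map_prod_map _ _ measurable_id (MeasurableEquiv.measurable _),
    Measure.map_map (MeasurableEquiv.measurable _)
      (measurable_id.prodMap (MeasurableEquiv.measurable _)),
    Measure.map_map (optionConsL2 E ι).continuous.measurable
      ((MeasurableEquiv.measurable _).comp
        (measurable_id.prodMap (MeasurableEquiv.measurable _))),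
    Measure.map_map (MeasurableEquiv.measurable _) hcons_meas]
  rfl

theorem map_piLpCongrLeft (e : ι ≃ κ) (μ : κ → Measure E) [∀ k, IsProbabilityMeasure (μ k)] :
    (piL2 fun i => μ (e i)).map (LinearIsometryEquiv.piLpCongrLeft 2 ℝ E e) = piL2 μ := by
  rw [piL2, piL2, ← Measure.pi_map_piCongrLeft e,
    Measure.map_map (LinearIsometryEquiv.continuous _).measurable (MeasurableEquiv.measurable _),
    Measure.map_map (MeasurableEquiv.measurable _) (MeasurableEquiv.measurable _)]
  congr 1
  funext x
  ext k
  simp [LinearIsometryEquiv.piLpCongrLeft_apply, MeasurableEquiv.coe_piCongrLeft,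
    Equiv.piCongrLeft_apply, Equiv.piCongrLeft'_apply]

end ProductMeasure

theorem piL2_induction {E : Type*} [NormedAddCommGroup E] [NormedSpace ℝ E] [MeasurableSpace E]
    [BorelSpace E] [SecondCountableTopology E] {S : Measure E → Prop}
    {P : ∀ {ι : Type u} [Fintype ι], Measure (PiLp 2 fun _ : ι => E) → Prop}
    (reindex : ∀ {ι κ : Type u} [Fintype ι] [Fintype κ] (e : ι ≃ κ)
      {ν : Measure (PiLp 2 fun _ : ι => E)}, P ν →
        P (ν.map (LinearIsometryEquiv.piLpCongrLeft 2 ℝ E e)))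
    (empty : P (Measure.dirac (0 : PiLp 2 fun _ : PEmpty => E)))
    (option : ∀ {ι : Type u} [Fintype ι] {μ : Measure E} {ν : Measure (PiLp 2 fun _ : ι => E)}
      [IsProbabilityMeasure μ] [IsProbabilityMeasure ν], S μ → P ν →
        P ((prodL2 μ ν).map (optionConsL2 E ι)))
    {ι : Type u} [Fintype ι] {μ : ι → Measure E} [∀ i, IsProbabilityMeasure (μ i)]
    (hμ : ∀ i, S (μ i)) : P (piL2 μ) := by
  refine Fintype.induction_empty_option (P := fun ι _ => ∀ μ : ι → Measure E,
    (∀ i, IsProbabilityMeasure (μ i)) → (∀ i, S (μ i)) → P (piL2 μ)) ?_ ?_ ?_ ι μ ‹_› hμ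
  · intro ι κ _ e ih μ _ hμ
    let : Fintype ι := Fintype.ofEquiv κ e.symm
    rw [← map_piLpCongrLeft e]
    exact reindex e (ih _ (fun i => inferInstance) fun i => hμ (e i))
  · intro μ _ _
    convert! empty
    rw [piL2, Measure.pi_of_empty μ 0, Measure.map_dirac']
    · rfl
    · exact MeasurableEquiv.measurable _
  · intro ι _ ih μ _ hμ
    rw [← map_optionConsL2]
    exact option (hμ none) (ih _ (fun i => inferInstance) fun i => hμ (some i))

/-! ### Maurey's convex property (τ) -/

section MoreauEnvelope

/-- The Moreau envelope of `φ`, that is, its infimal convolution with the cost `κ ‖·‖²`. It is used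
only for Lipschitz `φ` and `κ > 0`, where the infimum is finite. -/
noncomputable def moreauEnvelope {E : Type*} [Norm E] [Sub E] (κ : ℝ) (φ : E → ℝ) (x : E) : ℝ :=
  ⨅ z : E, (φ z + κ * ‖x - z‖ ^ 2)

theorem mul_le_sq_div_add_mul_sq {κ : ℝ} (hκ : 0 < κ) (a r : ℝ) :
    a * r ≤ a ^ 2 / (4 * κ) + κ * r ^ 2 := by
  have hsq : a ^ 2 / (4 * κ) + κ * r ^ 2 - a * r = (a - 2 * κ * r) ^ 2 / (4 * κ) := by
    field_simp
    ring
  have hsq_nonneg : 0 ≤ (a - 2 * κ * r) ^ 2 / (4 * κ) := by positivity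
  linarith

variable {E : Type*} [NormedAddCommGroup E] {φ ψ θ : E → ℝ} {L : NNReal} {κ : ℝ}

theorem bddBelow_moreauEnvelope (hκ : 0 < κ) (hφ : LipschitzWith L φ) (x : E) :
    BddBelow (Set.range fun z : E => φ z + κ * ‖x - z‖ ^ 2) := by
  refine ⟨φ x - L ^ 2 / (4 * κ), ?_⟩
  rintro _ ⟨z, rfl⟩
  have hLip := hφ.le_add_mul x z
  rw [dist_eq_norm] at hLip
  simp only
  linarith [mul_le_sq_div_add_mul_sq hκ L ‖x - z‖]

theorem moreauEnvelope_le (hκ : 0 < κ) (hφ : LipschitzWith L φ) (x z : E) :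
    moreauEnvelope κ φ x ≤ φ z + κ * ‖x - z‖ ^ 2 :=
  ciInf_le (bddBelow_moreauEnvelope hκ hφ x) z

theorem moreauEnvelope_le_moreauEnvelope_add (hκ : 0 < κ) (hφ : LipschitzWith L φ) {C : ℝ}
    (h : ∀ z, φ z ≤ ψ z + C) (x : E) : moreauEnvelope κ φ x ≤ moreauEnvelope κ ψ x + C := by
  rw [← sub_le_iff_le_add]
  refine le_ciInf fun z => ?_
  linarith [moreauEnvelope_le hκ hφ x z, h z]

theorem lipschitzWith_moreauEnvelope (hκ : 0 < κ) (hφ : LipschitzWith L φ) :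
    LipschitzWith L (moreauEnvelope κ φ) := by
  refine LipschitzWith.of_le_add_mul _ fun x y => ?_
  rw [← sub_le_iff_le_add]
  refine le_ciInf fun z => ?_
  have hinf := moreauEnvelope_le hκ hφ x (x - y + z)
  have hLip := hφ.le_add_mul (x - y + z) z
  rw [show x - (x - y + z) = y - z by abel] at hinf
  rw [dist_eq_norm, add_sub_cancel_right, ← dist_eq_norm] at hLip
  linarith

theorem moreauEnvelope_combo_le [NormedSpace ℝ E] (hκ : 0 < κ) (hθ : LipschitzWith L θ) {s t : ℝ}
    (hs : 0 ≤ s) (ht : 0 ≤ t) (hst : s + t = 1)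
    (h : ∀ z w, θ (s • z + t • w) ≤ s * φ z + t * ψ w) (x : E) :
    moreauEnvelope κ θ x ≤ s * moreauEnvelope κ φ x + t * moreauEnvelope κ ψ x := by
  refine le_of_forall_pos_le_add fun ε hε => ?_
  obtain ⟨z, hz⟩ := exists_lt_of_ciInf_lt (lt_add_of_pos_right (moreauEnvelope κ φ x) hε)
  obtain ⟨w, hw⟩ := exists_lt_of_ciInf_lt (lt_add_of_pos_right (moreauEnvelope κ ψ x) hε)
  have hcost : ‖x - (s • z + t • w)‖ ^ 2 ≤ s * ‖x - z‖ ^ 2 + t * ‖x - w‖ ^ 2 := by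
    have hx : x - (s • z + t • w) = s • (x - z) + t • (x - w) := by
      conv_lhs => rw [← one_smul ℝ x, ← hst]
      module
    rw [hx]
    exact ((convexOn_norm convex_univ).pow (fun _ _ => norm_nonneg _) 2).2 (Set.mem_univ _)
      (Set.mem_univ _) hs ht hst
  calc moreauEnvelope κ θ x
      ≤ θ (s • z + t • w) + κ * ‖x - (s • z + t • w)‖ ^ 2 := moreauEnvelope_le hκ hθ _ _
    _ ≤ s * (φ z + κ * ‖x - z‖ ^ 2) + t * (ψ w + κ * ‖x - w‖ ^ 2) := by
        linarith [h z w, mul_le_mul_of_nonneg_left hcost hκ.le]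
    _ ≤ s * (moreauEnvelope κ φ x + ε) + t * (moreauEnvelope κ ψ x + ε) := by gcongr
    _ = s * moreauEnvelope κ φ x + t * moreauEnvelope κ ψ x + (s + t) * ε := by ring
    _ = _ := by rw [hst, one_mul]

end MoreauEnvelope

section LogIntegralExp

variable {α : Type*} [MeasurableSpace α] {μ : Measure α} {p q r : α → ℝ}

theorem log_integral_exp_combo_le [NeZero μ]
    (hp : Integrable (fun x => exp (p x)) μ) (hq : Integrable (fun x => exp (q x)) μ)
    (hr : Integrable (fun x => exp (r x)) μ) {s t : ℝ} (hs : 0 ≤ s) (ht : 0 ≤ t)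
    (hst : s + t = 1) (h : ∀ x, r x ≤ s * p x + t * q x) :
    log (∫ x, exp (r x) ∂μ) ≤ s * log (∫ x, exp (p x) ∂μ) + t * log (∫ x, exp (q x) ∂μ) := by
  set P := log (∫ x, exp (p x) ∂μ) with hP
  set Q := log (∫ x, exp (q x) ∂μ) with hQ
  have hP_one : ∫ x, exp (p x - P) ∂μ = 1 := by
    simp only [exp_sub, integral_div, hP, exp_log (integral_exp_pos hp)]
    exact div_self (integral_exp_pos hp).ne'
  have hQ_one : ∫ x, exp (q x - Q) ∂μ = 1 := by
    simp only [exp_sub, integral_div, hQ, exp_log (integral_exp_pos hq)]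
    exact div_self (integral_exp_pos hq).ne'
  have hpP : Integrable (fun x => s * exp (p x - P)) μ := by
    simpa only [exp_sub] using (hp.div_const _).const_mul s
  have hqQ : Integrable (fun x => t * exp (q x - Q)) μ := by
    simpa only [exp_sub] using (hq.div_const _).const_mul t
  rw [log_le_iff_le_exp (integral_exp_pos hr)]
  calc ∫ x, exp (r x) ∂μ
      ≤ ∫ x, exp (s * P + t * Q) * (s * exp (p x - P) + t * exp (q x - Q)) ∂μ := by
        refine integral_mono hr ((hpP.add hqQ).const_mul _) fun x => ?_
        have hconv := convexOn_exp.2 (Set.mem_univ (p x - P)) (Set.mem_univ (q x - Q)) hs ht hst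
        simp only [smul_eq_mul] at hconv
        refine le_trans ?_ (mul_le_mul_of_nonneg_left hconv (exp_pos _).le)
        rw [← exp_add]
        exact exp_le_exp.2 ((h x).trans_eq (by ring))
    _ = exp (s * P + t * Q) := by
        rw [integral_const_mul, integral_add hpP hqQ, integral_const_mul, integral_const_mul,
          hP_one, hQ_one, mul_one, mul_one, hst, mul_one]

theorem log_integral_exp_le_add [NeZero μ] (hp : Integrable (fun x => exp (p x)) μ)
    (hq : Integrable (fun x => exp (q x)) μ) {C : ℝ} (h : ∀ x, p x ≤ q x + C) :
    log (∫ x, exp (p x) ∂μ) ≤ log (∫ x, exp (q x) ∂μ) + C := by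
  rw [log_le_iff_le_exp (integral_exp_pos hp), exp_add, exp_log (integral_exp_pos hq),
    ← integral_mul_const]
  refine integral_mono hp (hq.mul_const _) fun x => ?_
  rw [← exp_add]
  exact exp_le_exp.2 (h x)

theorem exp_integral_le_integral_exp [IsProbabilityMeasure μ] (hp : Integrable p μ)
    (hp_exp : Integrable (fun x => exp (p x)) μ) :
    exp (∫ x, p x ∂μ) ≤ ∫ x, exp (p x) ∂μ :=
  convexOn_exp.map_integral_le continuous_exp.continuousOn isClosed_univ
    (ae_of_all _ fun _ => Set.mem_univ _) hp hp_exp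

end LogIntegralExp

/-- Maurey's convex property `(τ)` for the cost `κ ‖·‖²`, restricted to Lipschitz functions. The
supremum of the admissible `h` is the Moreau envelope of `f`; a measurable minorant of it is used so
that the integrals make sense, and their convergence is part of the property. -/
def ConvexTau {E : Type*} [NormedAddCommGroup E] [NormedSpace ℝ E] [MeasurableSpace E]
    (μ : Measure E) (κ : ℝ) : Prop :=
  ∀ ⦃f h : E → ℝ⦄ ⦃L : NNReal⦄, ConvexOn ℝ Set.univ f → LipschitzWith L f → Measurable h →
    (∀ x y, h x ≤ f y + κ * ‖x - y‖ ^ 2) →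
      Integrable (fun x => exp (h x)) μ ∧ Integrable (fun x => exp (-f x)) μ ∧
        (∫ x, exp (h x) ∂μ) * ∫ x, exp (-f x) ∂μ ≤ 1

section BoundedSupport

theorem exp_sub_sq_add_exp_neg_le_two {u : ℝ} (h0 : 0 ≤ u) (h1 : u ≤ 1) :
    exp (u - u ^ 2) + exp (-u) ≤ 2 := by
  set v := u - u ^ 2 / 2 with hv
  have hv_sq : v ^ 2 ≤ u ^ 2 := by
    apply pow_le_pow_left₀ <;> nlinarith
  calc exp (u - u ^ 2) + exp (-u) = 2 * (exp (-(u ^ 2 / 2)) * cosh v) := by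
        rw [show u - u ^ 2 = -(u ^ 2 / 2) + v by ring, show -u = -(u ^ 2 / 2) + -v by ring, exp_add,
          exp_add, cosh_eq]
        ring
    _ ≤ 2 * (exp (-(u ^ 2 / 2)) * exp (v ^ 2 / 2)) := by
        gcongr
        exact cosh_le_exp_half_sq v
    _ ≤ 2 * 1 := by
        rw [← exp_add]
        gcongr
        exact exp_le_one_iff.2 (by linarith)
    _ = 2 := mul_one 2

theorem exp_add_exp_neg_le_two {u φ : ℝ} (hu : 0 ≤ u)
    (h : ∀ t ∈ Set.Icc (0 : ℝ) 1, φ ≤ (1 - t) * u + t ^ 2 / 4) : exp φ + exp (-u) ≤ 2 := by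
  rcases le_total u (1 / 2) with hu2 | hu2
  · have hφ : φ ≤ u - u ^ 2 :=
      (h (2 * u) ⟨by linarith, by linarith⟩).trans_eq (by ring)
    linarith [exp_le_exp.2 hφ, exp_sub_sq_add_exp_neg_le_two hu (by linarith)]
  · have hφ : φ ≤ 1 / 2 - (1 / 2) ^ 2 := by linarith [h 1 ⟨zero_le_one, le_rfl⟩]
    have hu' : exp (-u) ≤ exp (-(1 / 2)) := exp_le_exp.2 (by linarith)
    linarith [exp_le_exp.2 hφ,
      exp_sub_sq_add_exp_neg_le_two (u := 1 / 2) (by norm_num) (by norm_num)]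

theorem integral_exp_mul_integral_exp_le_one {α : Type*} [MeasurableSpace α] {μ : Measure α}
    [IsProbabilityMeasure μ] {p q : α → ℝ} (hp : Integrable (fun x => exp (p x)) μ)
    (hq : Integrable (fun x => exp (q x)) μ) {m : ℝ}
    (h : ∀ᵐ x ∂μ, exp (p x - m) + exp (q x + m) ≤ 2) :
    (∫ x, exp (p x) ∂μ) * ∫ x, exp (q x) ∂μ ≤ 1 := by
  set A := ∫ x, exp (p x - m) ∂μ with hA
  set B := ∫ x, exp (q x + m) ∂μ with hB
  have hp' : Integrable (fun x => exp (p x - m)) μ := by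
    simpa only [exp_sub] using hp.div_const _
  have hq' : Integrable (fun x => exp (q x + m)) μ := by
    simpa only [exp_add] using hq.mul_const _
  have hAB : A + B ≤ 2 := by
    calc A + B = ∫ x, (exp (p x - m) + exp (q x + m)) ∂μ := (integral_add hp' hq').symm
      _ ≤ ∫ _, (2 : ℝ) ∂μ := integral_mono_ae (hp'.add hq') (integrable_const _) h
      _ = 2 := by simp
  have hprod : (∫ x, exp (p x) ∂μ) * ∫ x, exp (q x) ∂μ = A * B := by
    simp only [hA, hB, exp_sub, exp_add, integral_div, integral_mul_const]
    field_simp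
  rw [hprod]
  have hA_nonneg : 0 ≤ A := integral_nonneg fun x => (exp_pos (p x - m)).le
  have hB_nonneg : 0 ≤ B := integral_nonneg fun x => (exp_pos (q x + m)).le
  nlinarith [sq_nonneg (A - B)]

theorem integrable_exp_of_ae_mem_of_le {E : Type*} [PseudoMetricSpace E] [MeasurableSpace E]
    {μ : Measure E} [IsFiniteMeasure μ] {K : Set E}
    (hμ : ∀ᵐ x ∂μ, x ∈ K) {D : ℝ} (hKD : ∀ x ∈ K, ∀ y ∈ K, dist x y ≤ D) {f h : E → ℝ}
    {L : NNReal} (hf : LipschitzWith L f) (hh : Measurable h) (hle : ∀ x, h x ≤ f x) :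
    Integrable (fun x => exp (h x)) μ := by
  rcases K.eq_empty_or_nonempty with rfl | ⟨y, hy⟩
  · obtain rfl : μ = 0 := by simpa using hμ
    exact integrable_zero_measure
  refine Integrable.of_bound hh.exp.aestronglyMeasurable (exp (f y + L * D)) ?_
  filter_upwards [hμ] with x hx
  rw [norm_of_nonneg (exp_pos _).le]
  refine exp_le_exp.2 ((hle x).trans ((hf.le_add_mul x y).trans ?_))
  gcongr
  exact hKD x hx y hy

theorem sub_sInf_image_le {E : Type*} [NormedAddCommGroup E] [NormedSpace ℝ E] {K : Set E} {D : ℝ}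
    (hD : 0 < D) (hKD : ∀ x ∈ K, ∀ y ∈ K, dist x y ≤ D) {f h : E → ℝ}
    (hf : ConvexOn ℝ Set.univ f) (hhf : ∀ x y, h x ≤ f y + 1 / (4 * D ^ 2) * ‖x - y‖ ^ 2) {x : E}
    (hx : x ∈ K) {t : ℝ} (ht0 : 0 ≤ t) (ht1 : t ≤ 1) :
    h x - sInf (f '' K) ≤ (1 - t) * (f x - sInf (f '' K)) + t ^ 2 / 4 := by
  refine le_of_forall_pos_le_add fun ε hε => ?_
  obtain ⟨_, ⟨y, hy, rfl⟩, hy_lt⟩ :=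
    exists_lt_of_csInf_lt ⟨_, Set.mem_image_of_mem f hx⟩ (lt_add_of_pos_right (sInf (f '' K)) hε)
  have hhx := hhf x ((1 - t) • x + t • y)
  have hfx := hf.2 (Set.mem_univ x) (Set.mem_univ y) (sub_nonneg.2 ht1) ht0 (sub_add_cancel 1 t)
  have hcost : 1 / (4 * D ^ 2) * ‖x - ((1 - t) • x + t • y)‖ ^ 2 ≤ t ^ 2 / 4 := by
    rw [show x - ((1 - t) • x + t • y) = t • (x - y) by module, norm_smul, norm_of_nonneg ht0,
      ← dist_eq_norm]
    calc 1 / (4 * D ^ 2) * (t * dist x y) ^ 2 ≤ 1 / (4 * D ^ 2) * (t * D) ^ 2 := by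
          gcongr
          exact hKD x hx y hy
      _ = t ^ 2 / 4 := by field_simp
  simp only [smul_eq_mul] at hfx
  nlinarith

theorem convexTau_of_bounded {E : Type*} [NormedAddCommGroup E] [NormedSpace ℝ E]
    [MeasurableSpace E] [BorelSpace E] {μ : Measure E} [IsProbabilityMeasure μ] {K : Set E}
    (hμ : ∀ᵐ x ∂μ, x ∈ K) {D : ℝ} (hD : 0 < D) (hKD : ∀ x ∈ K, ∀ y ∈ K, dist x y ≤ D) :
    ConvexTau μ (1 / (4 * D ^ 2)) := by
  intro f h L hf hL hh hhf
  obtain ⟨x₀, hx₀⟩ := hμ.exists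
  have hbdd : BddBelow (f '' K) := by
    refine ⟨f x₀ - L * D, ?_⟩
    rintro _ ⟨x, hx, rfl⟩
    have hdist := mul_le_mul_of_nonneg_left (hKD x₀ hx₀ x hx) L.coe_nonneg
    have hLip := hL.le_add_mul x₀ x
    linarith
  let m := sInf (f '' K)
  have hle : ∀ x, h x ≤ f x := fun x => by simpa using hhf x x
  have hhi : Integrable (fun x => exp (h x)) μ := integrable_exp_of_ae_mem_of_le hμ hKD hL hh hle
  have hfi : Integrable (fun x => exp (-f x)) μ :=
    integrable_exp_of_ae_mem_of_le hμ hKD hL.neg hL.continuous.measurable.neg fun _ => le_rfl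
  refine ⟨hhi, hfi, integral_exp_mul_integral_exp_le_one (m := m) hhi hfi ?_⟩
  filter_upwards [hμ] with x hx
  have hinterp : ∀ t ∈ Set.Icc (0 : ℝ) 1, h x - m ≤ (1 - t) * (f x - m) + t ^ 2 / 4 :=
    fun t ht => sub_sInf_image_le hD hKD hf hhf hx ht.1 ht.2
  have hfm : 0 ≤ f x - m := sub_nonneg.2 (csInf_le hbdd (Set.mem_image_of_mem f hx))
  convert! exp_add_exp_neg_le_two hfm hinterp using 3
  ring

end BoundedSupport

section Slice

variable {E F : Type*} [NormedAddCommGroup E] [NormedAddCommGroup F] {f : WithLp 2 (E × F) → ℝ}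

theorem lipschitzWith_slice {L : NNReal} (hL : LipschitzWith L f) (y : F) :
    LipschitzWith L fun x => f (WithLp.toLp 2 (x, y)) :=
  (hL.comp (isometry_toLp_mk_right y).lipschitz).weaken (mul_one L).le

variable [NormedSpace ℝ E] [NormedSpace ℝ F]

theorem convexOn_slice (hf : ConvexOn ℝ Set.univ f) (y : F) :
    ConvexOn ℝ Set.univ fun x => f (WithLp.toLp 2 (x, y)) := by
  refine ⟨convex_univ, fun a _ b _ s t hs ht hst => ?_⟩
  have hcombo : WithLp.toLp 2 (s • a + t • b, y) =
      s • WithLp.toLp 2 (a, y) + t • WithLp.toLp 2 (b, y) := by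
    rw [← WithLp.toLp_smul, ← WithLp.toLp_smul, ← WithLp.toLp_add, Prod.smul_mk, Prod.smul_mk,
      Prod.mk_add_mk, ← add_smul, hst, one_smul]
  simp only [hcombo]
  exact hf.2 (Set.mem_univ _) (Set.mem_univ _) hs ht hst

end Slice

section Tensorization

variable {E F : Type*} [NormedAddCommGroup E] [NormedSpace ℝ E] [MeasurableSpace E]
  [NormedAddCommGroup F] {μ : Measure E} {κ : ℝ} {L : NNReal} {f h : WithLp 2 (E × F) → ℝ}

/-- The function of the second variable produced by the tensorization of the convex property `(τ)`:
the logarithmic Laplace transform of the Moreau envelope of `f` in the first variable. -/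
noncomputable def tauMarginal (μ : Measure E) (κ : ℝ) (f : WithLp 2 (E × F) → ℝ) (y : F) : ℝ :=
  log (∫ x, exp (moreauEnvelope κ (fun x' => f (WithLp.toLp 2 (x', y))) x) ∂μ)

theorem ConvexTau.apply_moreauEnvelope [BorelSpace E] (hμ : ConvexTau μ κ) (hκ : 0 < κ) {φ : E → ℝ}
    (hφ : ConvexOn ℝ Set.univ φ) (hL : LipschitzWith L φ) :
    Integrable (fun x => exp (moreauEnvelope κ φ x)) μ ∧ Integrable (fun x => exp (-φ x)) μ ∧
      (∫ x, exp (moreauEnvelope κ φ x) ∂μ) * ∫ x, exp (-φ x) ∂μ ≤ 1 :=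
  hμ hφ hL (lipschitzWith_moreauEnvelope hκ hL).continuous.measurable
    fun x y => moreauEnvelope_le hκ hL x y

variable [NormedSpace ℝ F]

theorem ConvexTau.integrable_exp_slice (hμ : ConvexTau μ κ) (hf : ConvexOn ℝ Set.univ f)
    (hL : LipschitzWith L f) [MeasurableSpace F] (hh : Measurable h)
    (hhf : ∀ p q, h p ≤ f q + κ * ‖p - q‖ ^ 2) (y : F) :
    Integrable (fun x => exp (h (WithLp.toLp 2 (x, y)))) μ := by
  refine (hμ (convexOn_slice hf y) (lipschitzWith_slice hL y) (by fun_prop) fun x x' => ?_).1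
  refine (hhf _ (WithLp.toLp 2 (x', y))).trans_eq ?_
  simp [WithLp.prod_norm_sq_eq_of_L2]

variable [BorelSpace E] [NeZero μ]

theorem lipschitzWith_tauMarginal (hμ : ConvexTau μ κ) (hκ : 0 < κ) (hf : ConvexOn ℝ Set.univ f)
    (hL : LipschitzWith L f) : LipschitzWith L (tauMarginal μ κ f) := by
  refine LipschitzWith.of_le_add_mul _ fun a b => ?_
  refine log_integral_exp_le_add
    (hμ.apply_moreauEnvelope hκ (convexOn_slice hf a) (lipschitzWith_slice hL a)).1
    (hμ.apply_moreauEnvelope hκ (convexOn_slice hf b) (lipschitzWith_slice hL b)).1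
    (moreauEnvelope_le_moreauEnvelope_add hκ (lipschitzWith_slice hL a) fun z => ?_)
  rw [← (isometry_toLp_mk_left z).dist_eq a b]
  exact hL.le_add_mul _ _

theorem convexOn_tauMarginal (hμ : ConvexTau μ κ) (hκ : 0 < κ) (hf : ConvexOn ℝ Set.univ f)
    (hL : LipschitzWith L f) : ConvexOn ℝ Set.univ (tauMarginal μ κ f) := by
  have hint := fun y =>
    (hμ.apply_moreauEnvelope hκ (convexOn_slice hf y) (lipschitzWith_slice hL y)).1
  refine ⟨convex_univ, fun a _ b _ s t hs ht hst => ?_⟩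
  refine log_integral_exp_combo_le (hint a) (hint b) (hint _) hs ht hst
    (moreauEnvelope_combo_le hκ (lipschitzWith_slice hL _) hs ht hst fun z w => ?_)
  exact hf.2 (Set.mem_univ (WithLp.toLp 2 (z, a))) (Set.mem_univ (WithLp.toLp 2 (w, b))) hs ht hst

theorem integral_exp_neg_slice_le (hμ : ConvexTau μ κ) (hκ : 0 < κ) (hf : ConvexOn ℝ Set.univ f)
    (hL : LipschitzWith L f) (y : F) :
    ∫ x, exp (-f (WithLp.toLp 2 (x, y))) ∂μ ≤ exp (-tauMarginal μ κ f y) := by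
  obtain ⟨hint, -, hle⟩ :=
    hμ.apply_moreauEnvelope hκ (convexOn_slice hf y) (lipschitzWith_slice hL y)
  rw [exp_neg, tauMarginal, exp_log (integral_exp_pos hint), ← one_div,
    le_div_iff₀' (integral_exp_pos hint)]
  exact hle

theorem log_integral_exp_slice_le (hμ : ConvexTau μ κ) (hκ : 0 < κ) (hf : ConvexOn ℝ Set.univ f)
    (hL : LipschitzWith L f) [MeasurableSpace F] (hh : Measurable h)
    (hhf : ∀ p q, h p ≤ f q + κ * ‖p - q‖ ^ 2) (a b : F) :
    log (∫ x, exp (h (WithLp.toLp 2 (x, a))) ∂μ) ≤ tauMarginal μ κ f b + κ * ‖a - b‖ ^ 2 := by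
  refine log_integral_exp_le_add (hμ.integrable_exp_slice hf hL hh hhf a)
    (hμ.apply_moreauEnvelope hκ (convexOn_slice hf b) (lipschitzWith_slice hL b)).1 fun x => ?_
  rw [← sub_le_iff_le_add]
  refine le_ciInf fun z => ?_
  have hcost := hhf (WithLp.toLp 2 (x, a)) (WithLp.toLp 2 (z, b))
  rw [WithLp.prod_norm_sq_eq_of_L2] at hcost
  change h _ ≤ f _ + κ * (‖x - z‖ ^ 2 + ‖a - b‖ ^ 2) at hcost
  linarith

end Tensorization

section ConvexTau

variable {E F : Type*} [NormedAddCommGroup E] [NormedSpace ℝ E] [MeasurableSpace E] [BorelSpace E]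
  [NormedAddCommGroup F] [NormedSpace ℝ F] [MeasurableSpace F] [BorelSpace F] {κ : ℝ}

theorem ConvexTau.prod [SecondCountableTopology E] [SecondCountableTopology F]
    {μ : Measure E} {ν : Measure F} [IsProbabilityMeasure μ] [IsProbabilityMeasure ν]
    (hκ : 0 < κ) (hμ : ConvexTau μ κ) (hν : ConvexTau ν κ) : ConvexTau (prodL2 μ ν) κ := by
  intro f h L hf hL hh hhf
  have hh_exp : Measurable fun p : E × F => exp (h (WithLp.toLp 2 p)) := by fun_prop
  have hf_exp : Measurable fun p : E × F => exp (-f (WithLp.toLp 2 p)) := by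
    have := hL.continuous.measurable
    fun_prop
  have hslice_h := hμ.integrable_exp_slice hf hL hh hhf
  have hslice_f := fun y =>
    (hμ.apply_moreauEnvelope hκ (convexOn_slice hf y) (lipschitzWith_slice hL y)).2.1
  obtain ⟨hk_int, hg_int, hkg⟩ := hν (convexOn_tauMarginal hμ hκ hf hL)
    (lipschitzWith_tauMarginal hμ hκ hf hL)
    (measurable_log.comp hh_exp.stronglyMeasurable.integral_prod_left'.measurable)
    (log_integral_exp_slice_le hμ hκ hf hL hh hhf)
  simp only [Function.comp_apply, exp_log (integral_exp_pos (hslice_h _))] at hk_int hkg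
  have hh_int : Integrable (fun p => exp (h (WithLp.toLp 2 p))) (μ.prod ν) := by
    rw [integrable_prod_iff' hh_exp.aestronglyMeasurable]
    simpa only [norm_of_nonneg (exp_pos _).le] using And.intro (ae_of_all _ hslice_h) hk_int
  have hf_int : Integrable (fun p => exp (-f (WithLp.toLp 2 p))) (μ.prod ν) := by
    rw [integrable_prod_iff' hf_exp.aestronglyMeasurable]
    refine ⟨ae_of_all _ hslice_f, hg_int.mono'
      hf_exp.stronglyMeasurable.norm.integral_prod_left'.aestronglyMeasurable
      (ae_of_all _ fun y => ?_)⟩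
    simp only [norm_of_nonneg (exp_pos _).le,
      norm_of_nonneg (integral_nonneg fun _ => (exp_pos _).le)]
    exact integral_exp_neg_slice_le hμ hκ hf hL y
  rw [integrable_prodL2, integrable_prodL2, integral_prodL2, integral_prodL2]
  refine ⟨hh_int, hf_int, le_trans ?_ hkg⟩
  rw [integral_prod_symm _ hh_int, integral_prod_symm _ hf_int]
  refine mul_le_mul_of_nonneg_left ?_ (integral_nonneg fun _ => integral_nonneg fun _ =>
    (exp_pos _).le)
  exact integral_mono hf_int.integral_prod_right hg_int
    (integral_exp_neg_slice_le hμ hκ hf hL)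

theorem ConvexTau.map {μ : Measure E} (hμ : ConvexTau μ κ) (e : E ≃ₗᵢ[ℝ] F) :
    ConvexTau (μ.map e) κ := by
  intro f h L hf hL hh hhf
  have he : MeasurableEmbedding e := e.toHomeomorph.measurableEmbedding
  rw [he.integrable_map_iff, he.integrable_map_iff, he.integral_map, he.integral_map]
  refine hμ (hf.comp_linearMap e.toLinearEquiv.toLinearMap)
    ((hL.comp e.lipschitz).weaken (mul_one L).le) (hh.comp he.measurable) fun x y => ?_
  simpa only [← map_sub, e.norm_map] using hhf (e x) (e y)

theorem convexTau_dirac (x : E) : ConvexTau (Measure.dirac x) κ := by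
  intro f h L _ hL hh hhf
  have hh_exp : StronglyMeasurable fun y => exp (h y) := hh.exp.stronglyMeasurable
  have hf_exp : StronglyMeasurable fun y => exp (-f y) :=
    hL.continuous.measurable.neg.exp.stronglyMeasurable
  have hle : h x ≤ f x := by simpa using hhf x x
  refine ⟨integrable_dirac' hh_exp (by simp), integrable_dirac' hf_exp (by simp), ?_⟩
  rw [integral_dirac' _ _ hh_exp, integral_dirac' _ _ hf_exp, ← exp_add]
  exact exp_le_one_iff.2 (by linarith)

theorem ConvexTau.pi [SecondCountableTopology E] (hκ : 0 < κ) {ι : Type*} [Fintype ι]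
    {μ : ι → Measure E} [∀ i, IsProbabilityMeasure (μ i)] (hμ : ∀ i, ConvexTau (μ i) κ) :
    ConvexTau (piL2 μ) κ := by
  refine piL2_induction (S := fun ν => ConvexTau ν κ) (P := fun {_ _} ν => ConvexTau ν κ) ?_
    (convexTau_dirac 0) ?_ hμ
  · exact fun e ν hν => hν.map (LinearIsometryEquiv.piLpCongrLeft 2 ℝ E e)
  · exact fun hμ hν => (hμ.prod hκ hν).map (optionConsL2 E _)

theorem ConvexTau.integral_exp_mul_integral_exp_neg_le {μ : Measure E} (hκ : 0 < κ)
    (hμ : ConvexTau μ κ) {F : E → ℝ} {L : NNReal} (hF : ConvexOn ℝ Set.univ F)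
    (hL : LipschitzWith L F) {s : ℝ} (hs : 0 ≤ s) :
    Integrable (fun x => exp (s * F x)) μ ∧ Integrable (fun x => exp (-s * F x)) μ ∧
      (∫ x, exp (s * F x) ∂μ) * ∫ x, exp (-s * F x) ∂μ ≤ exp (s ^ 2 * (L ^ 2 / (4 * κ))) := by
  have hsL : LipschitzWith (s.toNNReal * L) fun x => s * F x := by
    refine LipschitzWith.of_le_add_mul _ fun x y => ?_
    rw [NNReal.coe_mul, coe_toNNReal s hs]
    linarith [mul_le_mul_of_nonneg_left (hL.le_add_mul x y) hs]
  obtain ⟨hpos, hneg, hle⟩ := hμ (h := fun x => s * F x - s ^ 2 * (L ^ 2 / (4 * κ)))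
    (hF.smul hs) hsL (hsL.continuous.measurable.sub_const _) fun x y => by
      have hLip := hsL.le_add_mul x y
      rw [NNReal.coe_mul, coe_toNNReal s hs, dist_eq_norm] at hLip
      have hyoung := mul_le_sq_div_add_mul_sq hκ (s * L) ‖x - y‖
      rw [mul_pow, mul_div_assoc] at hyoung
      simp only [smul_eq_mul]
      linarith
  simp only [smul_eq_mul, exp_sub, integral_div, ← neg_mul] at hpos hneg hle
  rw [div_mul_eq_mul_div, div_le_one (exp_pos _)] at hle
  simp only [div_eq_mul_inv] at hpos
  exact ⟨(integrable_mul_const_iff (inv_ne_zero (exp_ne_zero _)).isUnit _).1 hpos, hneg, hle⟩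

theorem ConvexTau.hasSubgaussianMGF {μ : Measure E} [IsProbabilityMeasure μ] (hκ : 0 < κ)
    (hμ : ConvexTau μ κ) {F : E → ℝ} {L : NNReal} (hF : ConvexOn ℝ Set.univ F)
    (hL : LipschitzWith L F) :
    HasSubgaussianMGF (fun x => F x - ∫ y, F y ∂μ) (Real.toNNReal (L ^ 2 / (2 * κ))) μ := by
  have hexp : ∀ s : ℝ, Integrable (fun x => exp (s * F x)) μ ∧
      (∫ x, exp (s * F x) ∂μ) * ∫ x, exp (-s * F x) ∂μ ≤ exp (s ^ 2 * (L ^ 2 / (4 * κ))) := by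
    intro s
    rcases le_total 0 s with hs | hs
    · obtain ⟨hint, -, hle⟩ := hμ.integral_exp_mul_integral_exp_neg_le hκ hF hL hs
      exact ⟨hint, hle⟩
    · obtain ⟨-, hint, hle⟩ :=
        hμ.integral_exp_mul_integral_exp_neg_le hκ hF hL (neg_nonneg.2 hs)
      rw [mul_comm]
      simpa only [neg_neg, neg_sq] using And.intro hint hle
  have hF_int : Integrable F μ := by
    simpa using integrable_pow_of_integrable_exp_mul one_ne_zero (hexp 1).1 (hexp (-1)).1 1
  refine ⟨fun t => ?_, fun t => ?_⟩
  · simpa only [mul_sub, exp_sub] using (hexp t).1.div_const _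
  have hjensen : exp (-t * ∫ y, F y ∂μ) ≤ ∫ x, exp (-t * F x) ∂μ := by
    rw [← integral_const_mul]
    exact exp_integral_le_integral_exp (hF_int.const_mul _) (hexp (-t)).1
  calc mgf (fun x => F x - ∫ y, F y ∂μ) μ t
      = (∫ x, exp (t * F x) ∂μ) * exp (-t * ∫ y, F y ∂μ) := by
        simp only [mgf, sub_eq_add_neg, mul_add, mul_neg, neg_mul, exp_add, integral_mul_const]
    _ ≤ (∫ x, exp (t * F x) ∂μ) * ∫ x, exp (-t * F x) ∂μ :=
        mul_le_mul_of_nonneg_left hjensen (integral_nonneg fun _ => (exp_pos _).le)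
    _ ≤ exp (t ^ 2 * (L ^ 2 / (4 * κ))) := (hexp t).2
    _ = exp (Real.toNNReal (L ^ 2 / (2 * κ)) * t ^ 2 / 2) := by
        rw [coe_toNNReal _ (by positivity)]
        ring_nf

theorem hasSubgaussianMGF_piL2_of_convexOn [SecondCountableTopology E] {ι : Type*} [Fintype ι]
    {μ : ι → Measure E} [∀ i, IsProbabilityMeasure (μ i)] {K : Set E}
    (hμ : ∀ i, ∀ᵐ x ∂(μ i), x ∈ K) {D : NNReal} (hKD : ∀ x ∈ K, ∀ y ∈ K, dist x y ≤ D)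
    {F : (PiLp 2 fun _ : ι => E) → ℝ} {L : NNReal} (hF : ConvexOn ℝ Set.univ F)
    (hL : LipschitzWith L F) :
    HasSubgaussianMGF (fun x => F x - ∫ y, F y ∂(piL2 μ)) (2 * D ^ 2 * L ^ 2) (piL2 μ) := by
  have hsub : ∀ R : NNReal, D < R →
      HasSubgaussianMGF (fun x => F x - ∫ y, F y ∂(piL2 μ)) (2 * R ^ 2 * L ^ 2) (piL2 μ) := by
    intro R hR
    have hR_pos : (0 : ℝ) < R := NNReal.coe_pos.2 (pos_of_gt hR)
    convert (ConvexTau.pi (by positivity) fun i => convexTau_of_bounded (hμ i) hR_pos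
      fun x hx y hy => (hKD x hx y hy).trans (NNReal.coe_le_coe.2 hR.le)).hasSubgaussianMGF
      (by positivity) hF hL
    rw [← NNReal.coe_inj, coe_toNNReal _ (by positivity)]
    push_cast
    field_simp
    ring
  refine ⟨(hsub (D + 1) (lt_add_one D)).integrable_exp_mul, fun t => ?_⟩
  have hcont : Continuous fun R : NNReal => exp ((2 * R ^ 2 * L ^ 2 : NNReal) * t ^ 2 / 2) := by
    fun_prop
  exact ge_of_tendsto (hcont.continuousWithinAt (s := Set.Ioi D))
    (eventually_mem_nhdsWithin.mono fun R hR => (hsub R hR).mgf_le t)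

end ConvexTau

/-! ### Entropy -/

section Entropy

variable {E F : Type*} [MeasurableSpace E] [MeasurableSpace F]

/-- The entropy of the density `exp G` with respect to `μ`. -/
noncomputable def expEntropy (μ : Measure E) (G : E → ℝ) : ℝ :=
  ∫ x, exp (G x) * (G x - log (∫ y, exp (G y) ∂μ)) ∂μ

theorem integrable_exp_of_abs_le {μ : Measure E} [IsFiniteMeasure μ] {G : E → ℝ} {M : ℝ}
    (hG : Measurable G) (hM : ∀ x, |G x| ≤ M) : Integrable (fun x => exp (G x)) μ :=
  Integrable.of_bound hG.exp.aestronglyMeasurable (exp M) (ae_of_all _ fun x => by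
    rw [norm_eq_abs, abs_exp]
    exact exp_le_exp.2 (le_of_abs_le (hM x)))

theorem integrable_exp_mul_of_abs_le {μ : Measure E} [IsFiniteMeasure μ] {G H : E → ℝ} {M M' : ℝ}
    (hG : Measurable G) (hM : ∀ x, |G x| ≤ M) (hH : Measurable H) (hM' : ∀ x, |H x| ≤ M') :
    Integrable (fun x => exp (G x) * H x) μ :=
  (integrable_exp_of_abs_le hG hM).mul_bdd hH.aestronglyMeasurable (ae_of_all _ hM')

variable {μ : Measure E} {ν : Measure F} [IsProbabilityMeasure μ] [IsProbabilityMeasure ν]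

theorem abs_log_integral_exp_le {G : E → ℝ} {M : ℝ} (hG : Measurable G) (hM : ∀ x, |G x| ≤ M) :
    |log (∫ x, exp (G x) ∂μ)| ≤ M := by
  have hint : Integrable (fun x => exp (G x)) μ := integrable_exp_of_abs_le hG hM
  have hpos := integral_exp_pos hint
  rw [abs_le, le_log_iff_exp_le hpos, log_le_iff_le_exp hpos]
  constructor
  · simpa using integral_mono (integrable_const (exp (-M))) hint fun x =>
      exp_le_exp.2 (neg_le_of_abs_le (hM x))
  · simpa using integral_mono hint (integrable_const (exp M)) fun x =>
      exp_le_exp.2 (le_of_abs_le (hM x))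

theorem integrable_expEntropy_integrand {G : E → ℝ} {M : ℝ} (hG : Measurable G)
    (hM : ∀ x, |G x| ≤ M) :
    Integrable (fun x => exp (G x) * (G x - log (∫ y, exp (G y) ∂μ))) μ :=
  integrable_exp_mul_of_abs_le hG hM (hG.sub_const _) fun x =>
    (abs_sub _ _).trans (add_le_add (hM x) (abs_log_integral_exp_le hG hM))

theorem integral_exp_mul_le_expEntropy {G H : E → ℝ} {M M' : ℝ} (hG : Measurable G)
    (hM : ∀ x, |G x| ≤ M) (hH : Measurable H) (hM' : ∀ x, |H x| ≤ M')
    (hH_one : ∫ x, exp (H x) ∂μ = 1) :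
    ∫ x, exp (G x) * H x ∂μ ≤ expEntropy μ G := by
  have hG_int : Integrable (fun x => exp (G x)) μ := integrable_exp_of_abs_le hG hM
  have hH_int : Integrable (fun x => exp (H x)) μ := integrable_exp_of_abs_le hH hM'
  have hdensity_pos := integral_exp_pos hG_int
  have hgap_int : Integrable (fun x => (∫ y, exp (G y) ∂μ) * exp (H x) - exp (G x)) μ :=
    (hH_int.const_mul _).sub hG_int
  have hpt : ∀ x, exp (G x) * H x ≤ exp (G x) * (G x - log (∫ y, exp (G y) ∂μ)) +
      ((∫ y, exp (G y) ∂μ) * exp (H x) - exp (G x)) := by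
    intro x
    have htangent := mul_le_mul_of_nonneg_left
      (add_one_le_exp (H x - G x + log (∫ y, exp (G y) ∂μ))) (exp_pos (G x)).le
    have hexp : exp (G x) * exp (H x - G x + log (∫ y, exp (G y) ∂μ)) =
        (∫ y, exp (G y) ∂μ) * exp (H x) := by
      rw [← exp_add, add_comm (H x - G x), add_left_comm, add_sub_cancel, exp_add,
        exp_log hdensity_pos]
    linarith
  calc ∫ x, exp (G x) * H x ∂μ
      ≤ ∫ x, (exp (G x) * (G x - log (∫ y, exp (G y) ∂μ)) +
          ((∫ y, exp (G y) ∂μ) * exp (H x) - exp (G x))) ∂μ :=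
        integral_mono (integrable_exp_mul_of_abs_le hG hM hH hM')
          ((integrable_expEntropy_integrand hG hM).add hgap_int) hpt
    _ = expEntropy μ G := by
        rw [integral_add (integrable_expEntropy_integrand hG hM) hgap_int,
          integral_sub (hH_int.const_mul _) hG_int, integral_const_mul, hH_one, mul_one, sub_self,
          add_zero, expEntropy]

theorem expEntropy_nonneg {G : E → ℝ} {M : ℝ} (hG : Measurable G) (hM : ∀ x, |G x| ≤ M) :
    0 ≤ expEntropy μ G := by
  simpa using integral_exp_mul_le_expEntropy (μ := μ) hG hM measurable_zero (H := 0) (M' := 0)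
    (by simp) (by simp)

variable {G : E × F → ℝ} {M : ℝ}

theorem measurable_log_integral_exp_left (hG : Measurable G) :
    Measurable fun y => log (∫ x, exp (G (x, y)) ∂μ) :=
  measurable_log.comp hG.exp.stronglyMeasurable.integral_prod_left'.measurable

theorem exp_log_integral_exp_left (hG : Measurable G) (hM : ∀ z, |G z| ≤ M) (y : F) :
    exp (log (∫ x, exp (G (x, y)) ∂μ)) = ∫ x, exp (G (x, y)) ∂μ :=
  exp_log (integral_exp_pos (integrable_exp_of_abs_le (by fun_prop) fun _ => hM _))

theorem abs_log_integral_exp_left_le (hG : Measurable G) (hM : ∀ z, |G z| ≤ M) (y : F) :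
    |log (∫ x, exp (G (x, y)) ∂μ)| ≤ M :=
  abs_log_integral_exp_le (by fun_prop) fun _ => hM _

theorem integrable_expEntropy_left (hG : Measurable G) (hM : ∀ z, |G z| ≤ M) :
    Integrable (fun y => expEntropy μ fun x => G (x, y)) ν :=
  (integrable_exp_mul_of_abs_le (μ := μ.prod ν) hG hM
    (hG.sub ((measurable_log_integral_exp_left hG).comp measurable_snd)) fun z =>
      (abs_sub _ _).trans (add_le_add (hM z) (abs_log_integral_exp_left_le hG hM z.2)))
    |>.integral_prod_right

theorem integrable_expEntropy_right (hG : Measurable G) (hM : ∀ z, |G z| ≤ M) :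
    Integrable (fun x => expEntropy ν fun y => G (x, y)) μ :=
  integrable_expEntropy_left (G := fun z : F × E => G z.swap) (by fun_prop) fun _ => hM _

theorem expEntropy_prod_eq (hG : Measurable G) (hM : ∀ z, |G z| ≤ M) :
    expEntropy (μ.prod ν) G = ∫ y, expEntropy μ (fun x => G (x, y)) ∂ν +
      expEntropy ν (fun y => log (∫ x, exp (G (x, y)) ∂μ)) := by
  have hmeas := measurable_log_integral_exp_left (μ := μ) hG
  have hbound := abs_log_integral_exp_left_le (μ := μ) hG hM
  have hcond_int : Integrable
      (fun z : E × F => exp (G z) * (G z - log (∫ x, exp (G (x, z.2)) ∂μ))) (μ.prod ν) :=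
    integrable_exp_mul_of_abs_le hG hM (hG.sub (hmeas.comp measurable_snd)) fun z =>
      (abs_sub _ _).trans (add_le_add (hM z) (hbound z.2))
  have hmarg_int : Integrable (fun z : E × F => exp (G z) * (log (∫ x, exp (G (x, z.2)) ∂μ) -
      log (∫ z, exp (G z) ∂(μ.prod ν)))) (μ.prod ν) :=
    integrable_exp_mul_of_abs_le hG hM ((hmeas.comp measurable_snd).sub_const _) fun z =>
      (abs_sub _ _).trans (add_le_add (hbound z.2) (abs_log_integral_exp_le hG hM))
  have hsplit : ∀ z : E × F, exp (G z) * (G z - log (∫ z, exp (G z) ∂(μ.prod ν))) =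
      exp (G z) * (G z - log (∫ x, exp (G (x, z.2)) ∂μ)) +
        exp (G z) * (log (∫ x, exp (G (x, z.2)) ∂μ) - log (∫ z, exp (G z) ∂(μ.prod ν))) :=
    fun z => by ring
  rw [expEntropy, integral_congr_ae (ae_of_all _ hsplit), integral_add hcond_int hmarg_int,
    integral_prod_symm _ hcond_int, integral_prod_symm _ hmarg_int,
    integral_prod_symm _ (integrable_exp_of_abs_le hG hM)]
  simp only [expEntropy, exp_log_integral_exp_left hG hM, integral_mul_const]

theorem expEntropy_log_integral_exp_le (hG : Measurable G) (hM : ∀ z, |G z| ≤ M) :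
    expEntropy ν (fun y => log (∫ x, exp (G (x, y)) ∂μ)) ≤
      ∫ x, expEntropy ν (fun y => G (x, y)) ∂μ := by
  let k : F → ℝ := fun y => log (∫ x, exp (G (x, y)) ∂μ)
  have hk_meas : Measurable k := measurable_log_integral_exp_left hG
  have hk_bound : ∀ y, |k y| ≤ M := abs_log_integral_exp_left_le hG hM
  let H : F → ℝ := fun y => k y - log (∫ y, exp (k y) ∂ν)
  have hH_bound : ∀ y, |H y| ≤ M + M := fun y =>
    (abs_sub _ _).trans (add_le_add (hk_bound y) (abs_log_integral_exp_le hk_meas hk_bound))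
  have hH_one : ∫ y, exp (H y) ∂ν = 1 := by
    have hpos := integral_exp_pos (integrable_exp_of_abs_le (μ := ν) hk_meas hk_bound)
    simp only [H, exp_sub, integral_div, exp_log hpos, div_self hpos.ne']
  have hint : Integrable (fun z : E × F => exp (G z) * H z.2) (μ.prod ν) :=
    integrable_exp_mul_of_abs_le hG hM (by fun_prop) fun z => hH_bound z.2
  calc expEntropy ν k = ∫ y, ∫ x, exp (G (x, y)) * H y ∂μ ∂ν := by
        simp only [expEntropy, integral_mul_const, H, k, exp_log_integral_exp_left hG hM]
    _ = ∫ x, ∫ y, exp (G (x, y)) * H y ∂ν ∂μ := by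
        rw [← integral_prod_symm _ hint, integral_prod _ hint]
    _ ≤ ∫ x, expEntropy ν (fun y => G (x, y)) ∂μ :=
        integral_mono hint.integral_prod_left (integrable_expEntropy_right hG hM) fun x =>
          integral_exp_mul_le_expEntropy (by fun_prop) (fun _ => hM _) (by fun_prop) hH_bound
            hH_one

theorem expEntropy_prod_le (hG : Measurable G) (hM : ∀ z, |G z| ≤ M) :
    expEntropy (μ.prod ν) G ≤
      ∫ y, expEntropy μ (fun x => G (x, y)) ∂ν + ∫ x, expEntropy ν (fun y => G (x, y)) ∂μ :=
  (expEntropy_prod_eq hG hM).trans_le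
    (add_le_add_right (expEntropy_log_integral_exp_le hG hM) _)

end Entropy

/-! ### Logarithmic Sobolev inequalities -/

theorem continuous_fderiv_fst {E F : Type*} [NormedAddCommGroup E] [NormedSpace ℝ E]
    [NormedAddCommGroup F] [NormedSpace ℝ F] {G : E × F → ℝ} (hG : ContDiff ℝ 1 G) :
    Continuous fun p : E × F => fderiv ℝ (fun x => G (x, p.2)) p.1 := by
  have hpartial : ∀ p : E × F, fderiv ℝ (fun x => G (x, p.2)) p.1 =
      fderiv ℝ G p ∘L ContinuousLinearMap.inl ℝ E F := fun p =>
    ((hG.differentiable one_ne_zero p).hasFDerivAt.comp p.1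
      (hasFDerivAt_prodMk_left p.1 p.2)).fderiv
  simpa only [hpartial] using (hG.continuous_fderiv one_ne_zero).clm_comp continuous_const

theorem continuous_fderiv_snd {E F : Type*} [NormedAddCommGroup E] [NormedSpace ℝ E]
    [NormedAddCommGroup F] [NormedSpace ℝ F] {G : E × F → ℝ} (hG : ContDiff ℝ 1 G) :
    Continuous fun p : E × F => fderiv ℝ (fun y => G (p.1, y)) p.2 :=
  (continuous_fderiv_fst (G := fun q : F × E => G q.swap)
    (hG.comp (contDiff_snd.prodMk contDiff_fst))).comp continuous_swap

theorem norm_sq_fderiv_fst_add_norm_sq_fderiv_snd {E F : Type*} [NormedAddCommGroup E]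
    [InnerProductSpace ℝ E] [CompleteSpace E] [NormedAddCommGroup F] [InnerProductSpace ℝ F]
    [CompleteSpace F] {G : WithLp 2 (E × F) → ℝ} {x : E} {y : F}
    (hG : DifferentiableAt ℝ G (WithLp.toLp 2 (x, y))) :
    ‖fderiv ℝ (fun x => G (WithLp.toLp 2 (x, y))) x‖ ^ 2 +
      ‖fderiv ℝ (fun y => G (WithLp.toLp 2 (x, y))) y‖ ^ 2 =
        ‖fderiv ℝ G (WithLp.toLp 2 (x, y))‖ ^ 2 := by
  obtain ⟨v, hv⟩ := (InnerProductSpace.toDual ℝ _).surjective (fderiv ℝ G (WithLp.toLp 2 (x, y)))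
  have hpair : HasFDerivAt (fun p => G (WithLp.toLp 2 p)) _ (x, y) :=
    hG.hasFDerivAt.comp (x, y) (WithLp.prodContinuousLinearEquiv 2 ℝ E F).symm.hasFDerivAt
  have hfst : fderiv ℝ (fun x => G (WithLp.toLp 2 (x, y))) x =
      InnerProductSpace.toDual ℝ E v.fst := by
    refine (HasFDerivAt.comp (g := fun p => G (WithLp.toLp 2 p)) x hpair
      (hasFDerivAt_prodMk_left x y)).fderiv.trans ?_
    ext u
    simp [← hv, WithLp.prod_inner_apply]
  have hsnd : fderiv ℝ (fun y => G (WithLp.toLp 2 (x, y))) y =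
      InnerProductSpace.toDual ℝ F v.snd := by
    refine (HasFDerivAt.comp (g := fun p => G (WithLp.toLp 2 p)) y hpair
      (hasFDerivAt_prodMk_right x y)).fderiv.trans ?_
    ext u
    simp [← hv, WithLp.prod_inner_apply]
  simp only [hfst, hsnd, ← hv, LinearIsometryEquiv.norm_map, WithLp.prod_norm_sq_eq_of_L2]

theorem integrable_norm_sq_mul_exp {X V : Type*} [TopologicalSpace X] [MeasurableSpace X]
    [OpensMeasurableSpace X] [SeminormedAddCommGroup V] {μ : Measure X} [IsFiniteMeasure μ]
    {D : X → V} {G : X → ℝ} {M M' : ℝ} (hD : Continuous D) (hD_le : ∀ x, ‖D x‖ ≤ M')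
    (hG : Measurable G) (hM : ∀ x, |G x| ≤ M) :
    Integrable (fun x => ‖D x‖ ^ 2 * exp (G x)) μ := by
  simp only [mul_comm (_ ^ 2)]
  refine integrable_exp_mul_of_abs_le hG hM (hD.norm.pow 2).measurable (M' := M' ^ 2) fun x => ?_
  rw [abs_pow, abs_norm]
  gcongr
  exact hD_le x

section ExpLogSobolev

variable {E F : Type*} [NormedAddCommGroup E] [MeasurableSpace E] [NormedAddCommGroup F]
  [MeasurableSpace F]

/-- The logarithmic Sobolev inequality with constant `c`, written for the test functions
`exp (G / 2)`: the squared length of their gradient is then `‖∇G‖² * exp G / 4`. -/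
def ExpLogSobolev [NormedSpace ℝ E] (μ : Measure E) (c : ℝ) : Prop :=
  ∀ G : E → ℝ, ContDiff ℝ 1 G → (∃ M : ℝ, ∀ x, |G x| ≤ M) → (∃ M : ℝ, ∀ x, ‖fderiv ℝ G x‖ ≤ M) →
    expEntropy μ G ≤ c / 2 * ∫ x, ‖fderiv ℝ G x‖ ^ 2 * exp (G x) ∂μ

theorem ExpLogSobolev.map [NormedSpace ℝ E] [NormedSpace ℝ F] [BorelSpace E] [BorelSpace F]
    {μ : Measure E} {c : ℝ} (h : ExpLogSobolev μ c) (e : E ≃ₗᵢ[ℝ] F) :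
    ExpLogSobolev (μ.map e) c := by
  rintro G hG ⟨M, hM⟩ ⟨M', hM'⟩
  have hemb : MeasurableEmbedding e := e.toHomeomorph.measurableEmbedding
  have hnorm : ∀ x, ‖fderiv ℝ (fun x => G (e x)) x‖ = ‖fderiv ℝ G (e x)‖ := fun x => by
    rw [← ContinuousLinearMap.opNorm_comp_linearIsometryEquiv _ e]
    exact congrArg norm (ContinuousLinearEquiv.comp_right_fderiv e.toContinuousLinearEquiv)
  simpa only [expEntropy, hemb.integral_map, hnorm] using
    h (fun x => G (e x)) (hG.comp e.contDiff) ⟨M, fun x => hM _⟩ ⟨M', fun x => hnorm x ▸ hM' _⟩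

theorem expLogSobolev_dirac [NormedSpace ℝ E] [MeasurableSingletonClass E] {c : ℝ} (hc : 0 ≤ c)
    (x : E) : ExpLogSobolev (Measure.dirac x) c := fun G _ _ _ => by
  simp only [expEntropy, integral_dirac, log_exp, sub_self, mul_zero]
  positivity

variable [InnerProductSpace ℝ E] [CompleteSpace E] [InnerProductSpace ℝ F] [CompleteSpace F]

variable [BorelSpace E] [BorelSpace F] [SecondCountableTopologyEither E F]

theorem ExpLogSobolev.prod {μ : Measure E} {ν : Measure F} [IsProbabilityMeasure μ]
    [IsProbabilityMeasure ν] {c : ℝ} (hμ : ExpLogSobolev μ c) (hν : ExpLogSobolev ν c) :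
    ExpLogSobolev (prodL2 μ ν) c := by
  rintro G hG ⟨M, hM⟩ ⟨M', hM'⟩
  let Γ : E × F → ℝ := fun p => G (WithLp.toLp 2 p)
  have hΓ : ContDiff ℝ 1 Γ := hG.comp (WithLp.prodContinuousLinearEquiv 2 ℝ E F).symm.contDiff
  let gradFst : E × F → E →L[ℝ] ℝ := fun p => fderiv ℝ (fun x => Γ (x, p.2)) p.1
  let gradSnd : E × F → F →L[ℝ] ℝ := fun p => fderiv ℝ (fun y => Γ (p.1, y)) p.2
  have hpyth : ∀ p, ‖gradFst p‖ ^ 2 + ‖gradSnd p‖ ^ 2 = ‖fderiv ℝ G (WithLp.toLp 2 p)‖ ^ 2 :=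
    fun p => norm_sq_fderiv_fst_add_norm_sq_fderiv_snd (hG.differentiable one_ne_zero _)
  have hgrad_le : ∀ p, ‖gradFst p‖ ≤ M' ∧ ‖gradSnd p‖ ≤ M' := fun p => by
    have hM'_nonneg := (norm_nonneg _).trans (hM' (WithLp.toLp 2 p))
    have hsq := pow_le_pow_left₀ (norm_nonneg _) (hM' (WithLp.toLp 2 p)) 2
    rw [← hpyth] at hsq
    exact ⟨le_of_sq_le_sq (by linarith [sq_nonneg ‖gradSnd p‖]) hM'_nonneg,
      le_of_sq_le_sq (by linarith [sq_nonneg ‖gradFst p‖]) hM'_nonneg⟩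
  have hfst_int : Integrable (fun p => ‖gradFst p‖ ^ 2 * exp (Γ p)) (μ.prod ν) :=
    integrable_norm_sq_mul_exp (continuous_fderiv_fst hΓ) (fun p => (hgrad_le p).1)
      hΓ.continuous.measurable fun _ => hM _
  have hsnd_int : Integrable (fun p => ‖gradSnd p‖ ^ 2 * exp (Γ p)) (μ.prod ν) :=
    integrable_norm_sq_mul_exp (continuous_fderiv_snd hΓ) (fun p => (hgrad_le p).2)
      hΓ.continuous.measurable fun _ => hM _
  calc expEntropy (prodL2 μ ν) G = expEntropy (μ.prod ν) Γ := by
        simp only [expEntropy, integral_prodL2, Γ]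
    _ ≤ ∫ y, expEntropy μ (fun x => Γ (x, y)) ∂ν + ∫ x, expEntropy ν (fun y => Γ (x, y)) ∂μ :=
        expEntropy_prod_le hΓ.continuous.measurable fun _ => hM _
    _ ≤ ∫ y, c / 2 * ∫ x, ‖gradFst (x, y)‖ ^ 2 * exp (Γ (x, y)) ∂μ ∂ν +
          ∫ x, c / 2 * ∫ y, ‖gradSnd (x, y)‖ ^ 2 * exp (Γ (x, y)) ∂ν ∂μ := by
        refine add_le_add
          (integral_mono (integrable_expEntropy_left hΓ.continuous.measurable fun _ => hM _)
            (hfst_int.integral_prod_right.const_mul _) fun y => ?_)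
          (integral_mono (integrable_expEntropy_right hΓ.continuous.measurable fun _ => hM _)
            (hsnd_int.integral_prod_left.const_mul _) fun x => ?_)
        · exact hμ _ (hΓ.comp (by fun_prop)) ⟨M, fun _ => hM _⟩ ⟨M', fun x => (hgrad_le (x, y)).1⟩
        · exact hν _ (hΓ.comp (by fun_prop)) ⟨M, fun _ => hM _⟩ ⟨M', fun y => (hgrad_le (x, y)).2⟩
    _ = c / 2 * ∫ z, ‖fderiv ℝ G z‖ ^ 2 * exp (G z) ∂(prodL2 μ ν) := by
        rw [integral_prodL2, integral_const_mul, integral_const_mul,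
          ← integral_prod_symm _ hfst_int, ← integral_prod _ hsnd_int, ← mul_add,
          ← integral_add hfst_int hsnd_int]
        simp only [← add_mul, hpyth, Γ]

theorem ExpLogSobolev.pi {ι : Type*} [Fintype ι] [SecondCountableTopology E] {μ : ι → Measure E}
    [∀ i, IsProbabilityMeasure (μ i)] {c : ℝ} (hc : 0 ≤ c) (hμ : ∀ i, ExpLogSobolev (μ i) c) :
    ExpLogSobolev (piL2 μ) c := by
  refine piL2_induction (S := fun ν => ExpLogSobolev ν c) (P := fun {_ _} ν => ExpLogSobolev ν c)
    ?_ (expLogSobolev_dirac hc 0) ?_ hμ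
  · exact fun e ν hν => hν.map (LinearIsometryEquiv.piLpCongrLeft 2 ℝ E e)
  · exact fun hμ hν => (hμ.prod hν).map (optionConsL2 E _)

end ExpLogSobolev

theorem LogSobolev.expLogSobolev {ν : Measure ℝ} [IsProbabilityMeasure ν] {c : ℝ}
    (h : LogSobolev ν c) : ExpLogSobolev ν c := by
  rintro G hG ⟨M, hM⟩ ⟨M', hM'⟩
  have hderiv : ∀ x, deriv (fun x => exp (G x / 2)) x = exp (G x / 2) * (deriv G x / 2) := fun x =>
    ((hG.differentiable one_ne_zero x).hasDerivAt.div_const 2).exp.deriv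
  have hexp_le : ∀ x, exp (G x / 2) ≤ exp (M / 2) := fun x =>
    exp_le_exp.2 (by linarith [le_of_abs_le (hM x)])
  have hlsi := h (fun x => exp (G x / 2)) (by fun_prop)
    ⟨exp (M / 2), fun x => by rw [abs_exp]; exact hexp_le x⟩
    ⟨exp (M / 2) * (M' / 2), fun x => by
      rw [hderiv, abs_mul, abs_exp, abs_div, abs_two]
      refine mul_le_mul (hexp_le x) ?_ (by positivity) (exp_pos _).le
      rw [← norm_eq_abs, norm_deriv_eq_norm_fderiv]
      linarith [hM' x]⟩
  have hsq : ∀ x, exp (G x / 2) ^ 2 = exp (G x) := fun x => by rw [← exp_nat_mul]; ring_nf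
  have hpos := integral_exp_pos (integrable_exp_of_abs_le (μ := ν) hG.continuous.measurable hM)
  simp only [hsq, log_div (exp_pos _).ne' hpos.ne', log_exp] at hlsi
  refine hlsi.trans_eq ?_
  rw [← integral_const_mul, ← integral_const_mul]
  congr 1 with x
  rw [hderiv, mul_pow, hsq, ← norm_deriv_eq_norm_fderiv, norm_eq_abs, sq_abs]
  ring

theorem LogSobolev.nonneg {ν : Measure ℝ} [IsProbabilityMeasure ν] {c : ℝ}
    (h : LogSobolev ν c) : 0 ≤ c := by
  have hG : ContDiff ℝ 1 arctan := contDiff_arctan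
  have hG_le : ∀ x, |arctan x| ≤ π / 2 := fun x =>
    abs_le.2 ⟨(neg_pi_div_two_lt_arctan x).le, (arctan_lt_pi_div_two x).le⟩
  have hnorm : ∀ x, ‖fderiv ℝ arctan x‖ = 1 / (1 + x ^ 2) := fun x => by
    rw [← norm_deriv_eq_norm_fderiv, (hasDerivAt_arctan x).deriv, norm_of_nonneg (by positivity)]
  have hnorm_le : ∀ x, ‖fderiv ℝ arctan x‖ ≤ 1 := fun x => by
    rw [hnorm]
    exact div_le_one_of_le₀ (by linarith [sq_nonneg x]) (by positivity)
  have henergy_pos : 0 < ∫ x, ‖fderiv ℝ arctan x‖ ^ 2 * exp (arctan x) ∂ν := by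
    refine (integral_pos_iff_support_of_nonneg (fun x => by positivity)
      (integrable_norm_sq_mul_exp (hG.continuous_fderiv one_ne_zero) hnorm_le
        measurable_arctan hG_le)).2 ?_
    have hsupp : Function.support (fun x => ‖fderiv ℝ arctan x‖ ^ 2 * exp (arctan x)) =
        Set.univ :=
      Set.eq_univ_of_forall fun x => by
        rw [Function.mem_support, hnorm]
        positivity
    simp only [hsupp, measure_univ, one_pos]
  have hle := (expEntropy_nonneg measurable_arctan hG_le).trans
    (h.expLogSobolev arctan hG ⟨_, hG_le⟩ ⟨1, hnorm_le⟩)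
  linarith [nonneg_of_mul_nonneg_left hle henergy_pos]

/-- The identification of `ℂ` with the Hilbert sum of its real and imaginary axes. -/
noncomputable def complexOfRealProdL2 : WithLp 2 (ℝ × ℝ) ≃ₗᵢ[ℝ] ℂ where
  toLinearEquiv := (WithLp.linearEquiv 2 ℝ (ℝ × ℝ)).trans Complex.equivRealProdLm.symm
  norm_map' p := by
    refine (sq_eq_sq₀ (norm_nonneg _) (norm_nonneg _)).1 ?_
    rw [Complex.sq_norm, Complex.normSq_apply, WithLp.prod_norm_sq_eq_of_L2]
    simp [sq]

theorem map_complexOfRealProdL2 (μ ν : Measure ℝ) :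
    (prodL2 μ ν).map complexOfRealProdL2 = entryLaw μ ν := by
  rw [prodL2, entryLaw, Measure.map_map complexOfRealProdL2.continuous.measurable
    (MeasurableEquiv.measurable _)]
  congr 1 with q
  apply Complex.ext <;> simp [complexOfRealProdL2]

theorem ExpLogSobolev.entryLaw {μ ν : Measure ℝ} [IsProbabilityMeasure μ]
    [IsProbabilityMeasure ν] {c : ℝ} (hμ : ExpLogSobolev μ c) (hν : ExpLogSobolev ν c) :
    ExpLogSobolev (entryLaw μ ν) c := by
  rw [← map_complexOfRealProdL2]
  exact (hμ.prod hν).map complexOfRealProdL2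

/-! ### Herbst's argument -/

theorem abs_const_mul_le {Ω : Type*} {F : Ω → ℝ} {M : ℝ} (hM : ∀ x, |F x| ≤ M) (s : ℝ) (x : Ω) :
    |s * F x| ≤ |s| * M := by
  rw [abs_mul]
  exact mul_le_mul_of_nonneg_left (hM x) (abs_nonneg s)

section Herbst

variable {Ω : Type*} [MeasurableSpace Ω] {μ : Measure Ω}

theorem integrableExpSet_eq_univ [IsFiniteMeasure μ] {F : Ω → ℝ} {M : ℝ} (hF : Measurable F)
    (hM : ∀ x, |F x| ≤ M) : integrableExpSet F μ = Set.univ :=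
  Set.eq_univ_of_forall fun s =>
    integrable_exp_of_abs_le (hF.const_mul s) (abs_const_mul_le hM s)

theorem mem_interior_integrableExpSet [IsFiniteMeasure μ] {F : Ω → ℝ} {M : ℝ} (hF : Measurable F)
    (hM : ∀ x, |F x| ≤ M) (s : ℝ) : s ∈ interior (integrableExpSet F μ) := by
  simp only [integrableExpSet_eq_univ hF hM, interior_univ, Set.mem_univ]

variable [IsProbabilityMeasure μ]

theorem expEntropy_const_mul {F : Ω → ℝ} {M : ℝ} (hF : Measurable F) (hM : ∀ x, |F x| ≤ M)
    (s : ℝ) :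
    expEntropy μ (fun x => s * F x) = mgf F μ s * (s * deriv (cgf F μ) s - cgf F μ s) := by
  have hexp_int : Integrable (fun x => exp (s * F x)) μ :=
    integrable_exp_of_abs_le (hF.const_mul s) (abs_const_mul_le hM s)
  have hmul_int : Integrable (fun x => exp (s * F x) * (s * F x)) μ :=
    integrable_exp_mul_of_abs_le (hF.const_mul s) (abs_const_mul_le hM s) (hF.const_mul s)
      (abs_const_mul_le hM s)
  have hmoment : ∫ x, exp (s * F x) * (s * F x) ∂μ = s * ∫ x, F x * exp (s * F x) ∂μ := by
    rw [← integral_const_mul]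
    congr 1 with x
    ring
  have hmgf_pos : 0 < mgf F μ s := mgf_pos hexp_int
  calc expEntropy μ (fun x => s * F x)
      = ∫ x, (exp (s * F x) * (s * F x) - exp (s * F x) * cgf F μ s) ∂μ := by
        simp only [expEntropy, mul_sub, cgf, mgf]
    _ = s * (∫ x, F x * exp (s * F x) ∂μ) - mgf F μ s * cgf F μ s := by
        rw [integral_sub hmul_int (hexp_int.mul_const _), hmoment, integral_mul_const, mgf]
    _ = mgf F μ s * (s * deriv (cgf F μ) s - cgf F μ s) := by
        rw [deriv_cgf (mem_interior_integrableExpSet hF hM s)]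
        field_simp

theorem tendsto_cgf_div_nhdsGT_zero {F : Ω → ℝ} {M : ℝ} (hF : Measurable F)
    (hM : ∀ x, |F x| ≤ M) :
    Tendsto (fun s => cgf F μ s / s) (𝓝[>] 0) (𝓝 (∫ x, F x ∂μ)) := by
  have hmem := mem_interior_integrableExpSet (μ := μ) hF hM 0
  have hderiv : HasDerivAt (cgf F μ) (∫ x, F x ∂μ) 0 := by
    simpa only [deriv_cgf_zero hmem, probReal_univ, div_one] using
      (analyticAt_cgf hmem).differentiableAt.hasDerivAt
  refine ((hasDerivAt_iff_tendsto_slope.1 hderiv).mono_left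
    (nhdsWithin_mono 0 fun s (hs : 0 < s) => hs.ne')).congr fun s => ?_
  rw [slope_def_field, cgf_zero, sub_zero, sub_zero]

/-- The entropy bound says that the derivative of `s ↦ cgf F μ s / s` is at most `C`. -/
theorem antitoneOn_cgf_div_sub {F : Ω → ℝ} {M C : ℝ} (hF : Measurable F) (hM : ∀ x, |F x| ≤ M)
    (hent : ∀ s : ℝ, 0 < s → expEntropy μ (fun x => s * F x) ≤ C * s ^ 2 * mgf F μ s) :
    AntitoneOn (fun s => cgf F μ s / s - C * s) (Set.Ioi 0) := by
  have hderiv : ∀ s : ℝ, 0 < s → HasDerivAt (fun s => cgf F μ s / s - C * s)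
      ((deriv (cgf F μ) s * s - cgf F μ s * 1) / s ^ 2 - C * 1) s := fun s hs =>
    ((analyticAt_cgf (mem_interior_integrableExpSet hF hM s)).differentiableAt.hasDerivAt.div
      (hasDerivAt_id s) hs.ne').sub ((hasDerivAt_id s).const_mul C)
  refine antitoneOn_of_hasDerivWithinAt_nonpos (convex_Ioi 0)
    (fun s hs => (hderiv s hs).continuousAt.continuousWithinAt)
    (fun s hs => (hderiv s (interior_subset hs)).hasDerivWithinAt) fun s hs => ?_
  have hs_pos : 0 < s := interior_subset hs
  have hmgf_pos : 0 < mgf F μ s :=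
    mgf_pos (integrable_exp_of_abs_le (hF.const_mul s) (abs_const_mul_le hM s))
  have hle := hent s hs_pos
  rw [expEntropy_const_mul hF hM, mul_comm, mul_le_mul_iff_left₀ hmgf_pos] at hle
  rw [sub_nonpos, div_le_iff₀ (by positivity)]
  linarith

theorem integral_exp_le_of_expEntropy_le {F : Ω → ℝ} {M C : ℝ} (hF : Measurable F)
    (hM : ∀ x, |F x| ≤ M)
    (hent : ∀ s : ℝ, 0 < s → expEntropy μ (fun x => s * F x) ≤ C * s ^ 2 * mgf F μ s) :
    ∫ x, exp (F x) ∂μ ≤ exp (∫ x, F x ∂μ + C) := by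
  have hlim : Tendsto (fun s => cgf F μ s / s - C * s) (𝓝[>] 0) (𝓝 (∫ x, F x ∂μ)) := by
    have hlin : Tendsto (fun s : ℝ => C * s) (𝓝[>] 0) (𝓝 0) :=
      ((continuous_const_mul C).tendsto' 0 0 (mul_zero C)).mono_left nhdsWithin_le_nhds
    simpa only [sub_zero] using (tendsto_cgf_div_nhdsGT_zero hF hM).sub hlin
  have hle : cgf F μ 1 / 1 - C * 1 ≤ ∫ x, F x ∂μ := by
    refine ge_of_tendsto hlim ?_
    filter_upwards [Ioo_mem_nhdsGT (zero_lt_one (α := ℝ))] with s hs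
    exact antitoneOn_cgf_div_sub hF hM hent hs.1 (Set.mem_Ioi.2 one_pos) hs.2.le
  have hcgf : log (∫ x, exp (F x) ∂μ) = cgf F μ 1 := by simp only [cgf, mgf, one_mul]
  rw [← log_le_iff_le_exp (integral_exp_pos (integrable_exp_of_abs_le hF hM)), hcgf]
  linarith

end Herbst

/-! ### Lipschitz functions under a logarithmic Sobolev inequality -/

theorem exists_contDiff_lipschitzWith_abs_sub_le {E : Type*} [NormedAddCommGroup E]
    [NormedSpace ℝ E] [FiniteDimensional ℝ E] [MeasurableSpace E] [BorelSpace E] {F : E → ℝ}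
    {L : NNReal} (hF : LipschitzWith L F) {ε : ℝ} (hε : 0 < ε) :
    ∃ G : E → ℝ, ContDiff ℝ 1 G ∧ LipschitzWith L G ∧ ∀ x, |G x - F x| ≤ ε := by
  let ρ : Measure E := Measure.addHaar
  have hr : 0 < ε / (L + 1) := by positivity
  let φ : ContDiffBump (0 : E) := ⟨ε / (L + 1) / 2, ε / (L + 1), half_pos hr, half_lt_self hr⟩
  refine ⟨convolution (φ.normed ρ) F (ContinuousLinearMap.lsmul ℝ ℝ) ρ,
    φ.hasCompactSupport_normed.contDiff_convolution_left _ φ.contDiff_normed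
      hF.continuous.locallyIntegrable, LipschitzWith.of_dist_le_mul fun x y => ?_, fun x => ?_⟩
  · have hint : ∀ z, Integrable (fun t => φ.normed ρ t * F (z - t)) ρ := fun z =>
      (φ.continuous_normed.mul (hF.continuous.comp (by fun_prop))).integrable_of_hasCompactSupport
        φ.hasCompactSupport_normed.mul_right
    simp only [convolution_def, ContinuousLinearMap.lsmul_apply, smul_eq_mul]
    rw [dist_eq_norm, ← integral_sub (hint x) (hint y)]
    calc ‖∫ t, (φ.normed ρ t * F (x - t) - φ.normed ρ t * F (y - t)) ∂ρ‖
        ≤ ∫ t, φ.normed ρ t * (L * dist x y) ∂ρ := by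
          refine norm_integral_le_of_norm_le (φ.integrable_normed.mul_const _)
            (ae_of_all _ fun t => ?_)
          rw [← mul_sub, norm_mul, norm_of_nonneg (φ.nonneg_normed t), ← dist_eq_norm]
          refine mul_le_mul_of_nonneg_left ?_ (φ.nonneg_normed t)
          simpa only [dist_sub_right] using hF.dist_le_mul (x - t) (y - t)
      _ = L * dist x y := by rw [integral_mul_const, φ.integral_normed, one_mul]
  · rw [← dist_eq]
    refine φ.dist_normed_convolution_le hF.continuous.aestronglyMeasurable fun z hz => ?_
    calc dist (F z) (F x) ≤ L * dist z x := hF.dist_le_mul z x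
      _ ≤ (L + 1) * (ε / (L + 1)) :=
          mul_le_mul (by linarith) (Metric.mem_ball.1 hz).le dist_nonneg (by positivity)
      _ = ε := by field_simp

theorem integrable_and_integral_le_of_tendsto {Ω : Type*} [MeasurableSpace Ω] {μ : Measure Ω}
    {u : ℕ → Ω → ℝ} {g : Ω → ℝ} {B : ℝ} (hu_nonneg : ∀ k x, 0 ≤ u k x)
    (hu : ∀ k, Integrable (u k) μ) (hB : ∀ k, ∫ x, u k x ∂μ ≤ B)
    (hlim : ∀ x, Tendsto (fun k => u k x) atTop (𝓝 (g x))) :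
    Integrable g μ ∧ ∫ x, g x ∂μ ≤ B := by
  have hg_nonneg : ∀ x, 0 ≤ g x := fun x => ge_of_tendsto' (hlim x) fun k => hu_nonneg k x
  have hg : AEStronglyMeasurable g μ :=
    aestronglyMeasurable_of_tendsto_ae atTop (fun k => (hu k).1) (ae_of_all _ hlim)
  have hle : ∫⁻ x, ENNReal.ofReal (g x) ∂μ ≤ ENNReal.ofReal B := by
    calc ∫⁻ x, ENNReal.ofReal (g x) ∂μ
        = ∫⁻ x, liminf (fun k => ENNReal.ofReal (u k x)) atTop ∂μ := by
          congr 1 with x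
          exact ((ENNReal.continuous_ofReal.tendsto _).comp (hlim x)).liminf_eq.symm
      _ ≤ liminf (fun k => ∫⁻ x, ENNReal.ofReal (u k x) ∂μ) atTop :=
          lintegral_liminf_le' fun k => (hu k).1.aemeasurable.ennreal_ofReal
      _ ≤ liminf (fun _ : ℕ => ENNReal.ofReal B) atTop := by
          refine liminf_le_liminf (Eventually.of_forall fun k => ?_)
          simp only [← ofReal_integral_eq_lintegral_ofReal (hu k) (ae_of_all _ (hu_nonneg k))]
          exact ENNReal.ofReal_le_ofReal (hB k)
      _ = ENNReal.ofReal B := liminf_const _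
  refine ⟨⟨hg, ?_⟩, ?_⟩
  · rw [hasFiniteIntegral_iff_ofReal (ae_of_all _ hg_nonneg)]
    exact hle.trans_lt ENNReal.ofReal_lt_top
  · rw [integral_eq_lintegral_of_nonneg_ae (ae_of_all _ hg_nonneg) hg]
    exact ENNReal.toReal_le_of_le_ofReal ((integral_nonneg (hu_nonneg 0)).trans (hB 0)) hle

section ExpLogSobolev

variable {E : Type*} [NormedAddCommGroup E] [NormedSpace ℝ E] [MeasurableSpace E] [BorelSpace E]
  {μ : Measure E} [IsProbabilityMeasure μ] {c : ℝ} {F : E → ℝ} {L : NNReal}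

theorem ExpLogSobolev.integral_exp_le_of_contDiff (h : ExpLogSobolev μ c) (hc : 0 ≤ c)
    (hF : LipschitzWith L F) (hd : ContDiff ℝ 1 F) {M : ℝ} (hM : ∀ x, |F x| ≤ M) :
    ∫ x, exp (F x) ∂μ ≤ exp (∫ x, F x ∂μ + c / 2 * L ^ 2) := by
  refine integral_exp_le_of_expEntropy_le hd.continuous.measurable hM fun s _ => ?_
  have hd_mul : ContDiff ℝ 1 fun x => s * F x := contDiff_const.mul hd
  have hgrad : ∀ x, ‖fderiv ℝ (fun x => s * F x) x‖ ≤ |s| * L := fun x => by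
    rw [fderiv_const_mul (hd.differentiable one_ne_zero x), norm_smul, norm_eq_abs]
    exact mul_le_mul_of_nonneg_left (norm_fderiv_le_of_lipschitz ℝ hF) (abs_nonneg s)
  have hexp_int : Integrable (fun x => exp (s * F x)) μ :=
    integrable_exp_of_abs_le hd_mul.continuous.measurable (abs_const_mul_le hM s)
  calc expEntropy μ (fun x => s * F x)
      ≤ c / 2 * ∫ x, ‖fderiv ℝ (fun x => s * F x) x‖ ^ 2 * exp (s * F x) ∂μ :=
        h _ hd_mul ⟨_, abs_const_mul_le hM s⟩ ⟨_, hgrad⟩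
    _ ≤ c / 2 * ∫ x, (|s| * L) ^ 2 * exp (s * F x) ∂μ := by
        refine mul_le_mul_of_nonneg_left (integral_mono_of_nonneg (ae_of_all _ fun x => ?_)
          (hexp_int.const_mul _) (ae_of_all _ fun x => ?_)) (by positivity)
        · positivity
        · dsimp only
          gcongr
          exact hgrad x
    _ = c / 2 * L ^ 2 * s ^ 2 * mgf F μ s := by
        rw [integral_const_mul, mul_pow, sq_abs, mgf]
        ring

theorem ExpLogSobolev.integral_exp_le_of_bounded [FiniteDimensional ℝ E] (h : ExpLogSobolev μ c)
    (hc : 0 ≤ c) (hF : LipschitzWith L F) {M : ℝ} (hM : ∀ x, |F x| ≤ M) :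
    ∫ x, exp (F x) ∂μ ≤ exp (∫ x, F x ∂μ + c / 2 * L ^ 2) := by
  have hF_int : Integrable F μ :=
    .of_bound hF.continuous.measurable.aestronglyMeasurable M (ae_of_all _ hM)
  have hexp_int := integrable_exp_of_abs_le (μ := μ) hF.continuous.measurable hM
  rw [← log_le_iff_le_exp (integral_exp_pos hexp_int)]
  refine le_of_forall_pos_le_add fun ε hε => ?_
  obtain ⟨G, hGd, hG, hGF⟩ := exists_contDiff_lipschitzWith_abs_sub_le hF (half_pos hε)
  have hGM : ∀ x, |G x| ≤ ε / 2 + M := fun x => by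
    simpa only [sub_add_cancel] using
      (abs_add_le (G x - F x) (F x)).trans (add_le_add (hGF x) (hM x))
  have hmean : ∫ x, G x ∂μ ≤ ∫ x, F x ∂μ + ε / 2 := by
    calc ∫ x, G x ∂μ ≤ ∫ x, (F x + ε / 2) ∂μ :=
          integral_mono
            (.of_bound hG.continuous.measurable.aestronglyMeasurable _ (ae_of_all _ hGM))
            (hF_int.add (integrable_const _)) fun x => by linarith [le_of_abs_le (hGF x)]
      _ = ∫ x, F x ∂μ + ε / 2 := by
          rw [integral_add hF_int (integrable_const _), integral_const, probReal_univ, one_smul]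
  rw [log_le_iff_le_exp (integral_exp_pos hexp_int)]
  calc ∫ x, exp (F x) ∂μ ≤ ∫ x, exp (ε / 2) * exp (G x) ∂μ :=
        integral_mono hexp_int
          ((integrable_exp_of_abs_le hG.continuous.measurable hGM).const_mul _) fun x => by
          dsimp only
          rw [← exp_add]
          exact exp_le_exp.2 (by linarith [neg_le_of_abs_le (hGF x)])
    _ = exp (ε / 2) * ∫ x, exp (G x) ∂μ := integral_const_mul _ _
    _ ≤ exp (ε / 2) * exp (∫ x, G x ∂μ + c / 2 * L ^ 2) := by
        gcongr
        exact h.integral_exp_le_of_contDiff hc hG hGd hGM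
    _ ≤ exp (∫ x, F x ∂μ + c / 2 * L ^ 2 + ε) := by
        rw [← exp_add]
        exact exp_le_exp.2 (by linarith)

/-- The exponential bound for `-min |F| k` controls the mean of `min |F| k` uniformly in `k`. -/
theorem ExpLogSobolev.integrable [FiniteDimensional ℝ E] (h : ExpLogSobolev μ c) (hc : 0 ≤ c)
    (hF : LipschitzWith L F) : Integrable F μ := by
  let T : ℕ → E → ℝ := fun k x => min |F x| k
  have hT : ∀ k, LipschitzWith L (T k) := fun k =>
    ((lipschitzWith_one_norm.comp hF).weaken (one_mul L).le).min_const k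
  have hT_nonneg : ∀ k x, 0 ≤ T k x := fun k x => le_min (abs_nonneg _) k.cast_nonneg
  have hT_abs_le : ∀ (k : ℕ) x, |T k x| ≤ k := fun k x => by
    rw [abs_of_nonneg (hT_nonneg k x)]
    exact min_le_right _ _
  have hneg_abs_le : ∀ (k : ℕ) x, |-T k x| ≤ k := fun k x => (abs_neg _).trans_le (hT_abs_le k x)
  have hexp_int : Integrable (fun x => exp (-|F x|)) μ :=
    .of_bound hF.continuous.abs.neg.rexp.measurable.aestronglyMeasurable 1
      (ae_of_all _ fun x => by
        rw [norm_eq_abs, abs_exp]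
        exact exp_le_one_iff.2 (neg_nonpos.2 (abs_nonneg _)))
  have hmean : ∀ k, ∫ x, T k x ∂μ ≤ c / 2 * L ^ 2 - log (∫ x, exp (-|F x|) ∂μ) := fun k => by
    have hle : ∫ x, exp (-|F x|) ∂μ ≤ ∫ x, exp (-T k x) ∂μ :=
      integral_mono hexp_int
        (integrable_exp_of_abs_le (hT k).continuous.neg.measurable (hneg_abs_le k))
        fun x => exp_le_exp.2 (neg_le_neg (min_le_left _ _))
    have hlog := (log_le_iff_le_exp (integral_exp_pos hexp_int)).2
      (hle.trans (h.integral_exp_le_of_bounded hc (hT k).neg (hneg_abs_le k)))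
    rw [integral_neg] at hlog
    linarith
  have hlim : ∀ x, Tendsto (fun k => T k x) atTop (𝓝 |F x|) := fun x => by
    refine tendsto_const_nhds.congr' ?_
    filter_upwards [tendsto_natCast_atTop_atTop.eventually_ge_atTop |F x|] with k hk
    exact (min_eq_left hk).symm
  have habs := (integrable_and_integral_le_of_tendsto hT_nonneg
    (fun k => .of_bound (hT k).continuous.measurable.aestronglyMeasurable k
      (ae_of_all _ (hT_abs_le k))) hmean hlim).1
  exact (integrable_norm_iff hF.continuous.measurable.aestronglyMeasurable).1 habs

theorem ExpLogSobolev.integral_exp_sub_le [FiniteDimensional ℝ E] (h : ExpLogSobolev μ c)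
    (hc : 0 ≤ c) (hF : LipschitzWith L F) :
    Integrable (fun x => exp (F x - ∫ y, F y ∂μ)) μ ∧
      ∫ x, exp (F x - ∫ y, F y ∂μ) ∂μ ≤ exp (c / 2 * L ^ 2) := by
  let T : ℕ → E → ℝ := fun k x => max (min (F x) k) (-k)
  have hT : ∀ k, LipschitzWith L (T k) := fun k => (hF.min_const k).max_const (-k)
  have hT_le : ∀ k x, |T k x| ≤ k := fun k x =>
    abs_le.2 ⟨le_max_right _ _, max_le (min_le_right _ _) (neg_le_self k.cast_nonneg)⟩
  have hT_le_abs : ∀ k x, |T k x| ≤ |F x| := fun k x => by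
    have hx := abs_nonneg (F x)
    exact abs_le.2 ⟨le_max_of_le_left (le_min (neg_abs_le _) (by linarith)),
      max_le ((min_le_left _ _).trans (le_abs_self _)) (by linarith)⟩
  have hlim : ∀ x, Tendsto (fun k => T k x) atTop (𝓝 (F x)) := fun x => by
    refine tendsto_const_nhds.congr' ?_
    filter_upwards [tendsto_natCast_atTop_atTop.eventually_ge_atTop |F x|] with k hk
    simp only [T, min_eq_left (abs_le.1 hk).2, max_eq_left (abs_le.1 hk).1]
  have hmean : Tendsto (fun k => ∫ x, T k x ∂μ) atTop (𝓝 (∫ x, F x ∂μ)) :=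
    tendsto_integral_of_dominated_convergence (fun x => |F x|)
      (fun k => (hT k).continuous.measurable.aestronglyMeasurable) (h.integrable hc hF).abs
      (fun k => ae_of_all _ (hT_le_abs k)) (ae_of_all _ hlim)
  refine integrable_and_integral_le_of_tendsto
    (u := fun k x => exp (T k x - ∫ y, T k y ∂μ)) (fun k x => (exp_pos _).le) (fun k => ?_)
    (fun k => ?_) (fun x => (continuous_exp.tendsto _).comp ((hlim x).sub hmean))
  · simp only [exp_sub]
    exact (integrable_exp_of_abs_le (hT k).continuous.measurable (hT_le k)).div_const _
  · simp only [exp_sub]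
    rw [integral_div, div_le_iff₀ (exp_pos _), ← exp_add, add_comm]
    exact h.integral_exp_le_of_bounded hc (hT k) (hT_le k)

theorem ExpLogSobolev.hasSubgaussianMGF [FiniteDimensional ℝ E] {c : NNReal}
    (h : ExpLogSobolev μ c) (hF : LipschitzWith L F) :
    HasSubgaussianMGF (fun x => F x - ∫ y, F y ∂μ) (c * L ^ 2) μ := by
  have hmul : ∀ t : ℝ, LipschitzWith (‖t‖₊ * L) fun x => t * F x := fun t =>
    (lipschitzWith_smul t).comp hF
  have hbound := fun t : ℝ => h.integral_exp_sub_le c.coe_nonneg (hmul t)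
  simp only [integral_const_mul, ← mul_sub] at hbound
  refine ⟨fun t => (hbound t).1, fun t => (hbound t).2.trans_eq ?_⟩
  push_cast
  rw [mul_pow, norm_eq_abs, sq_abs]
  ring_nf

end ExpLogSobolev

/-! ### The spectral statistic of a Hermitian array -/

theorem lipschitzWith_lipConst {f : ℝ → ℝ} {L : NNReal} (hf : LipschitzWith L f) :
    LipschitzWith (lipConst f).toNNReal f := by
  have hbdd : BddAbove (Set.range fun p : {p : ℝ × ℝ // p.1 ≠ p.2} =>
      |f p.1.1 - f p.1.2| / |p.1.1 - p.1.2|) :=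
    ⟨L, Set.forall_mem_range.2 fun p =>
      div_le_of_le_mul₀ (abs_nonneg _) L.2 (hf.dist_le_mul p.1.1 p.1.2)⟩
  refine LipschitzWith.of_dist_le' fun x y => ?_
  rcases eq_or_ne x y with rfl | hxy
  · simp only [dist_self, mul_zero, le_refl]
  · exact (div_le_iff₀ (dist_pos.2 hxy)).1 (le_ciSup hbdd ⟨(x, y), hxy⟩)

theorem lipConst_nonneg (f : ℝ → ℝ) : 0 ≤ lipConst f :=
  iSup_nonneg fun _ => by positivity

section HermitianArray

variable {N : ℕ}

/-- The positions on and above the diagonal. -/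
abbrev UpperIndex (N : ℕ) : Type := {p : Fin N × Fin N // p.1 ≤ p.2}

/-- The self-adjoint array with prescribed entries above the diagonal. On the diagonal only the real
parts of the prescribed entries are used, which makes the array self-adjoint for every `w`. -/
noncomputable def hermitianArray :
    EuclideanSpace ℂ (UpperIndex N) →ₗ[ℝ] Fin N → Fin N → ℂ where
  toFun w i j :=
    if h : i < j then w ⟨(i, j), h.le⟩
    else if h : j < i then (starRingEnd ℂ) (w ⟨(j, i), h.le⟩)
    else ((w ⟨(i, i), le_rfl⟩).re : ℂ)
  map_add' w w' := by
    ext i j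
    simp only [Pi.add_apply, PiLp.add_apply]
    split_ifs <;> simp
  map_smul' t w := by
    ext i j
    simp only [Pi.smul_apply, PiLp.smul_apply]
    split_ifs <;> simp

theorem hermitianArray_of_lt (w : EuclideanSpace ℂ (UpperIndex N)) {i j : Fin N} (h : i < j) :
    hermitianArray w i j = w ⟨(i, j), h.le⟩ :=
  dif_pos h

theorem hermitianArray_self (w : EuclideanSpace ℂ (UpperIndex N)) (i : Fin N) :
    hermitianArray w i i = ((w ⟨(i, i), le_rfl⟩).re : ℂ) :=
  (dif_neg (lt_irrefl i)).trans (dif_neg (lt_irrefl i))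

theorem hermitianArray_conj (w : EuclideanSpace ℂ (UpperIndex N)) (i j : Fin N) :
    hermitianArray w i j = (starRingEnd ℂ) (hermitianArray w j i) := by
  have hlower : ∀ {i j : Fin N}, j < i →
      hermitianArray w i j = (starRingEnd ℂ) (hermitianArray w j i) := fun h => by
    rw [hermitianArray_of_lt w h]
    exact (dif_neg h.not_gt).trans (dif_pos h)
  rcases lt_trichotomy i j with h | rfl | h
  · rw [hlower h, Complex.conj_conj]
  · rw [hermitianArray_self, Complex.conj_ofReal]
  · exact hlower h

theorem hermitianArray_toLp_eq {v : Fin N → Fin N → ℂ}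
    (hv : ∀ i j, v i j = (starRingEnd ℂ) (v j i)) :
    hermitianArray (WithLp.toLp 2 fun p : UpperIndex N => v p.1.1 p.1.2) = v := by
  ext i j
  rcases lt_trichotomy i j with h | rfl | h
  · rw [hermitianArray_of_lt _ h]
  · rw [hermitianArray_self]
    exact Complex.conj_eq_iff_re.1 (hv i i).symm
  · rw [hermitianArray_conj, hermitianArray_of_lt _ h]
    exact (hv i j).symm

theorem norm_hermitianArray_le (w : EuclideanSpace ℂ (UpperIndex N)) (p : UpperIndex N) :
    ‖hermitianArray w p.1.1 p.1.2‖ ≤ ‖w p‖ := by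
  obtain ⟨⟨i, j⟩, hij⟩ := p
  rcases lt_or_eq_of_le (show i ≤ j from hij) with h | rfl
  · rw [hermitianArray_of_lt w h]
  · rw [hermitianArray_self, Complex.norm_real]
    exact Complex.abs_re_le_norm _

theorem sum_norm_sq_hermitianArray_le (w : EuclideanSpace ℂ (UpperIndex N)) :
    ∑ i, ∑ j, ‖hermitianArray w i j‖ ^ 2 ≤ 2 * ‖w‖ ^ 2 := by
  let u : Fin N → Fin N → ℝ := fun i j => if i ≤ j then ‖hermitianArray w i j‖ ^ 2 else 0
  have hu : ∑ i, ∑ j, u i j ≤ ‖w‖ ^ 2 := by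
    calc ∑ i, ∑ j, u i j = ∑ p : UpperIndex N, ‖hermitianArray w p.1.1 p.1.2‖ ^ 2 := by
          rw [← Fintype.sum_prod_type', ← Finset.sum_filter]
          exact Finset.sum_subtype _ (by simp) _
      _ ≤ ‖w‖ ^ 2 := by
          rw [EuclideanSpace.norm_sq_eq]
          gcongr with p
          exact norm_hermitianArray_le w p
  have hsplit : ∀ i j, ‖hermitianArray w i j‖ ^ 2 ≤ u i j + u j i := fun i j => by
    have hsymm : ‖hermitianArray w j i‖ = ‖hermitianArray w i j‖ := by
      rw [hermitianArray_conj w j i, RCLike.norm_conj]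
    rcases lt_trichotomy i j with h | rfl | h
    · simp only [u, h.le, h.not_ge, if_true, if_false, add_zero, le_refl]
    · simp only [u, le_refl, if_true, le_add_iff_nonneg_left, sq_nonneg]
    · simp only [u, h.le, h.not_ge, if_true, if_false, zero_add, hsymm, le_refl]
  calc ∑ i, ∑ j, ‖hermitianArray w i j‖ ^ 2 ≤ ∑ i, ∑ j, (u i j + u j i) :=
        Finset.sum_le_sum fun i _ => Finset.sum_le_sum fun j _ => hsplit i j
    _ = 2 * ∑ i, ∑ j, u i j := by
        simp only [Finset.sum_add_distrib]
        rw [Finset.sum_comm (f := fun i j => u j i), two_mul]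
    _ ≤ 2 * ‖w‖ ^ 2 := by gcongr

end HermitianArray

section SpectralStat

variable {N : ℕ} {A : Matrix (Fin N) (Fin N) ℂ}

theorem sum_norm_sq_weightedMatrix_le {a : ℝ} (ha : ∀ i j, ‖A i j‖ ≤ a)
    (v : Fin N → Fin N → ℂ) :
    ∑ i, ∑ j, ‖weightedMatrix A v i j‖ ^ 2 ≤ a ^ 2 / N * ∑ i, ∑ j, ‖v i j‖ ^ 2 := by
  simp only [Finset.mul_sum]
  refine Finset.sum_le_sum fun i _ => Finset.sum_le_sum fun j _ => ?_
  have hsq : ‖((1 / √N : ℝ) : ℂ)‖ ^ 2 = 1 / N := by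
    rw [Complex.norm_real, norm_eq_abs, sq_abs, div_pow, one_pow, sq_sqrt N.cast_nonneg]
  calc ‖weightedMatrix A v i j‖ ^ 2 = ‖A i j‖ ^ 2 / N * ‖v i j‖ ^ 2 := by
        rw [weightedMatrix, of_apply, norm_mul, norm_mul, mul_pow, mul_pow, hsq]
        ring
    _ ≤ a ^ 2 / N * ‖v i j‖ ^ 2 := by
        gcongr
        exact ha i j

/-- The random matrix as a real-linear function of the entries on and above the diagonal. -/
noncomputable def upperMatrix (A : Matrix (Fin N) (Fin N) ℂ) :
    EuclideanSpace ℂ (UpperIndex N) →ₗ[ℝ] Matrix (Fin N) (Fin N) ℂ where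
  toFun w := weightedMatrix A (hermitianArray w)
  map_add' w w' := by
    ext i j
    simp only [weightedMatrix, map_add, of_apply, Matrix.add_apply, Pi.add_apply, mul_add]
  map_smul' t w := by
    ext i j
    simp only [weightedMatrix, map_smul, of_apply, Matrix.smul_apply, Pi.smul_apply,
      RingHom.id_apply, mul_smul_comm]

theorem upperMatrix_isHermitian (hA : A.IsHermitian) (w : EuclideanSpace ℂ (UpperIndex N)) :
    (upperMatrix A w).IsHermitian :=
  weightedMatrix_isHermitian hA (hermitianArray_conj w)

theorem sqrt_sum_norm_sq_upperMatrix_le {a : ℝ} (ha_nonneg : 0 ≤ a) (ha : ∀ i j, ‖A i j‖ ≤ a)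
    (w : EuclideanSpace ℂ (UpperIndex N)) :
    √(∑ i, ∑ j, ‖upperMatrix A w i j‖ ^ 2) ≤ √2 * a / √N * ‖w‖ := by
  refine sqrt_le_iff.2 ⟨by positivity, ?_⟩
  calc ∑ i, ∑ j, ‖upperMatrix A w i j‖ ^ 2
      ≤ a ^ 2 / N * ∑ i, ∑ j, ‖hermitianArray w i j‖ ^ 2 := sum_norm_sq_weightedMatrix_le ha _
    _ ≤ a ^ 2 / N * (2 * ‖w‖ ^ 2) := by
        gcongr
        exact sum_norm_sq_hermitianArray_le w
    _ = (√2 * a / √N * ‖w‖) ^ 2 := by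
        rw [mul_pow, div_pow, mul_pow, sq_sqrt zero_le_two, sq_sqrt N.cast_nonneg]
        ring

/-- The spectral statistic as a real function of the entries on and above the diagonal. -/
noncomputable def upperStat (f : ℝ → ℝ) (A : Matrix (Fin N) (Fin N) ℂ)
    (w : EuclideanSpace ℂ (UpperIndex N)) : ℝ :=
  (N : ℝ)⁻¹ * (cfc f (upperMatrix A w)).trace.re

theorem spectralStat_eq_upperStat (hA : A.IsHermitian) (f : ℝ → ℝ) {v : Fin N → Fin N → ℂ}
    (hv : ∀ i j, v i j = (starRingEnd ℂ) (v j i)) :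
    spectralStat f A v =
      (upperStat f A (WithLp.toLp 2 fun p : UpperIndex N => v p.1.1 p.1.2) : ℂ) := by
  have hmatrix : upperMatrix A (WithLp.toLp 2 fun p : UpperIndex N => v p.1.1 p.1.2) =
      weightedMatrix A v := congrArg (weightedMatrix A) (hermitianArray_toLp_eq hv)
  have hX := weightedMatrix_isHermitian hA hv
  rw [spectralStat, normTrace, upperStat, hmatrix, re_trace_cfc_eq_sum_eigenvalues f hX,
    trace_cfc_eq_sum_eigenvalues f hX]
  push_cast
  rfl

theorem convexOn_upperStat (hA : A.IsHermitian) {f : ℝ → ℝ} (hf : ConvexOn ℝ Set.univ f) :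
    ConvexOn ℝ Set.univ (upperStat f A) := by
  have hdom : upperMatrix A ⁻¹' {X | X.IsHermitian} = Set.univ :=
    Set.eq_univ_of_forall (upperMatrix_isHermitian hA)
  exact hdom ▸ ((convexOn_re_trace_cfc hf).comp_linearMap (upperMatrix A)).smul
    (inv_nonneg.2 N.cast_nonneg)

theorem lipschitzWith_upperStat (hA : A.IsHermitian) {a : ℝ} (ha_nonneg : 0 ≤ a)
    (ha : ∀ i j, ‖A i j‖ ≤ a) {f : ℝ → ℝ} {L : NNReal} (hf : LipschitzWith L f) :
    LipschitzWith (√2 * a * lipConst f / N).toNNReal (upperStat f A) := by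
  refine LipschitzWith.of_dist_le' fun w w' => ?_
  have htrace := abs_re_trace_cfc_sub_le (upperMatrix_isHermitian hA w)
    (upperMatrix_isHermitian hA w') (lipschitzWith_lipConst hf)
  rw [← map_sub, coe_toNNReal _ (lipConst_nonneg f), Fintype.card_fin] at htrace
  calc dist (upperStat f A w) (upperStat f A w')
      = (N : ℝ)⁻¹ * |(cfc f (upperMatrix A w)).trace.re - (cfc f (upperMatrix A w')).trace.re| := by
        rw [dist_eq, upperStat, upperStat, ← mul_sub, abs_mul, abs_of_nonneg (by positivity)]
    _ ≤ (N : ℝ)⁻¹ * (lipConst f * √N * (√2 * a / √N * ‖w - w'‖)) := by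
        have hL := lipConst_nonneg f
        gcongr
        refine htrace.trans ?_
        gcongr
        exact sqrt_sum_norm_sq_upperMatrix_le ha_nonneg ha (w - w')
    _ = √2 * a * lipConst f / N * dist w w' := by
        rcases N.eq_zero_or_pos with rfl | hN
        · simp
        · rw [dist_eq_norm]
          field_simp

end SpectralStat

/-! ### Deviation bounds -/

section Deviation

variable {Ω : Type*} [MeasurableSpace Ω] {P : Measure Ω}

theorem measureReal_abs_ge_le_of_hasSubgaussianMGF {X : Ω → ℝ} {κ : NNReal}
    (h : HasSubgaussianMGF X κ P) {δ : ℝ} (hδ : 0 ≤ δ) :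
    P.real {x | δ ≤ |X x|} ≤ 2 * exp (-δ ^ 2 / (2 * κ)) := by
  have hunion : {x | δ ≤ |X x|} = {x | δ ≤ X x} ∪ {x | δ ≤ (-X) x} :=
    Set.ext fun x => le_abs (a := δ) (b := X x)
  calc P.real {x | δ ≤ |X x|} ≤ P.real {x | δ ≤ X x} + P.real {x | δ ≤ (-X) x} :=
        hunion ▸ measureReal_union_le _ _
    _ ≤ exp (-δ ^ 2 / (2 * κ)) + exp (-δ ^ 2 / (2 * κ)) :=
        add_le_add (h.measure_ge_le hδ) (h.neg.measure_ge_le hδ)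
    _ = 2 * exp (-δ ^ 2 / (2 * κ)) := (two_mul _).symm

theorem hasLaw_piL2 {E ι : Type*} [MeasurableSpace E] [Fintype ι] {μ : ι → Measure E}
    {X : ι → Ω → E} (hX : ∀ i, HasLaw (X i) (μ i) P) (hind : iIndepFun X P) :
    HasLaw (fun x => WithLp.toLp 2 fun i => X i x) (piL2 μ) P :=
  HasLaw.comp ⟨(MeasurableEquiv.toLp 2 (ι → E)).measurable.aemeasurable, rfl⟩ (hind.hasLaw_pi hX)

theorem integrable_and_deviation_le_of_hasLaw {E : Type*} [MeasurableSpace E] {ν : Measure E}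
    [IsProbabilityMeasure ν] {Y : Ω → E} (hY : HasLaw Y ν P) {F : E → ℝ} {κ : NNReal}
    (h : HasSubgaussianMGF (fun w => F w - ∫ w', F w' ∂ν) κ ν) :
    Integrable (fun x => (F (Y x) : ℂ)) P ∧ ∀ δ : ℝ, 0 ≤ δ →
      P.real {x | δ ≤ ‖(F (Y x) : ℂ) - ∫ y, (F (Y y) : ℂ) ∂P‖} ≤
        2 * exp (-δ ^ 2 / (2 * κ)) := by
  have : IsProbabilityMeasure P := hY.isProbabilityMeasure_iff.2 ‹_›
  have hF_int : Integrable F ν :=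
    (h.integrable.add (integrable_const (∫ w, F w ∂ν))).congr (ae_of_all _ fun _ => by simp)
  have hmean : ∫ x, (F (Y x) : ℂ) ∂P = ((∫ w, F w ∂ν : ℝ) : ℂ) := by
    rw [integral_complex_ofReal]
    exact congrArg _ (hY.integral_comp hF_int.aestronglyMeasurable)
  rw [← hY.map_eq] at h hF_int
  refine ⟨(hF_int.comp_aemeasurable hY.aemeasurable).ofReal, fun δ hδ => ?_⟩
  simp only [hmean, ← Complex.ofReal_sub, Complex.norm_real, norm_eq_abs]
  rw [← hY.map_eq]
  exact measureReal_abs_ge_le_of_hasSubgaussianMGF (h.of_map hY.aemeasurable) hδ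

end Deviation

section SpectralStat

variable {Ω : Type*} [MeasurableSpace Ω] {P : Measure Ω} {N : ℕ} {A : Matrix (Fin N) (Fin N) ℂ}
  {a : ℝ} {ω : Fin N → Fin N → Ω → ℂ} {f : ℝ → ℝ} {L : NNReal}
  {μ : UpperIndex N → Measure ℂ} [∀ p, IsProbabilityMeasure (μ p)]

theorem spectralStat_deviation_le_of_hasSubgaussianMGF {κ : NNReal} (hA : A.IsHermitian)
    (ha_nonneg : 0 ≤ a) (hsa : ∀ i j x, ω i j x = (starRingEnd ℂ) (ω j i x))
    (hlaw : ∀ p : UpperIndex N, HasLaw (ω p.1.1 p.1.2) (μ p) P)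
    (hind : iIndepFun (fun p : UpperIndex N => ω p.1.1 p.1.2) P)
    (h : HasSubgaussianMGF (fun w => upperStat f A w - ∫ w', upperStat f A w' ∂(piL2 μ))
      (κ * (√2 * a * lipConst f / N).toNNReal ^ 2) (piL2 μ)) :
    Integrable (fun x => spectralStat f A fun i j => ω i j x) P ∧ ∀ δ : ℝ, 0 ≤ δ →
      P.real {x | δ ≤ ‖spectralStat f A (fun i j => ω i j x) -
          ∫ y, spectralStat f A (fun i j => ω i j y) ∂P‖} ≤
        2 * exp (-(1 / (4 * κ * a ^ 2 * lipConst f ^ 2)) * (N : ℝ) ^ 2 * δ ^ 2) := by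
  obtain ⟨hint, hdev⟩ := integrable_and_deviation_le_of_hasLaw (hasLaw_piL2 hlaw hind) h
  simp only [spectralStat_eq_upperStat hA f fun i j => hsa i j _]
  refine ⟨hint, fun δ hδ => (hdev δ hδ).trans_eq ?_⟩
  have hlip := lipConst_nonneg f
  have hproxy : 2 * (κ * (√2 * a * lipConst f / N) ^ 2) =
      4 * κ * a ^ 2 * lipConst f ^ 2 / N ^ 2 := by
    rw [div_pow, mul_pow, mul_pow, sq_sqrt zero_le_two]
    ring
  rw [NNReal.coe_mul, NNReal.coe_pow, coe_toNNReal _ (by positivity), hproxy, div_div_eq_mul_div]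
  ring_nf

theorem spectralStat_deviation_le_of_isBounded (hA : A.IsHermitian) (ha_nonneg : 0 ≤ a)
    (ha : ∀ i j, ‖A i j‖ ≤ a) (hsa : ∀ i j x, ω i j x = (starRingEnd ℂ) (ω j i x))
    (hlaw : ∀ p : UpperIndex N, HasLaw (ω p.1.1 p.1.2) (μ p) P)
    (hind : iIndepFun (fun p : UpperIndex N => ω p.1.1 p.1.2) P)
    {K : Set ℂ} (hK : Bornology.IsBounded K) (hμ : ∀ p, μ p Kᶜ = 0)
    (hconv : ConvexOn ℝ Set.univ f) (hf : LipschitzWith L f) :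
    Integrable (fun x => spectralStat f A fun i j => ω i j x) P ∧ ∀ δ : ℝ, 0 ≤ δ →
      P.real {x | δ ≤ ‖spectralStat f A (fun i j => ω i j x) -
          ∫ y, spectralStat f A (fun i j => ω i j y) ∂P‖} ≤
        2 * exp (-(1 / (8 * (Metric.diam K ^ 2 * a ^ 2 * lipConst f ^ 2))) * (N : ℝ) ^ 2 *
          δ ^ 2) := by
  have hsub := hasSubgaussianMGF_piL2_of_convexOn (fun p => mem_ae_iff.2 (hμ p))
    (fun x hx y hy => (Metric.dist_le_diam_of_mem hK hx hy).trans (le_coe_toNNReal _))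
    (convexOn_upperStat hA hconv) (lipschitzWith_upperStat hA ha_nonneg ha hf)
  convert spectralStat_deviation_le_of_hasSubgaussianMGF hA ha_nonneg hsa hlaw hind hsub using 8
  rw [NNReal.coe_mul, NNReal.coe_pow, NNReal.coe_ofNat, coe_toNNReal _ Metric.diam_nonneg]
  ring

theorem spectralStat_deviation_le_of_expLogSobolev {c : NNReal} (hA : A.IsHermitian)
    (ha_nonneg : 0 ≤ a) (ha : ∀ i j, ‖A i j‖ ≤ a)
    (hsa : ∀ i j x, ω i j x = (starRingEnd ℂ) (ω j i x))
    (hlaw : ∀ p : UpperIndex N, HasLaw (ω p.1.1 p.1.2) (μ p) P)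
    (hind : iIndepFun (fun p : UpperIndex N => ω p.1.1 p.1.2) P)
    (hμ : ∀ p, ExpLogSobolev (μ p) c) (hf : LipschitzWith L f) :
    Integrable (fun x => spectralStat f A fun i j => ω i j x) P ∧ ∀ δ : ℝ, 0 ≤ δ →
      P.real {x | δ ≤ ‖spectralStat f A (fun i j => ω i j x) -
          ∫ y, spectralStat f A (fun i j => ω i j y) ∂P‖} ≤
        2 * exp (-(1 / (4 * (c * a ^ 2 * lipConst f ^ 2))) * (N : ℝ) ^ 2 * δ ^ 2) := by
  have hsub := (ExpLogSobolev.pi c.coe_nonneg hμ).hasSubgaussianMGF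
    (lipschitzWith_upperStat hA ha_nonneg ha hf)
  simpa only [mul_assoc] using
    spectralStat_deviation_le_of_hasSubgaussianMGF hA ha_nonneg hsa hlaw hind hsub

end SpectralStat

theorem exp_neg_inv_mul_sq_le {k l q s t : ℝ} (hk : 0 < k) (hkl : k ≤ l) (hq : 0 ≤ q) (hs : 0 ≤ s)
    (hst : s ≤ t) (n : ℝ) :
    exp (-(1 / (k * q)) * n ^ 2 * t ^ 2) ≤ exp (-(1 / (l * q)) * n ^ 2 * s ^ 2) := by
  have hinv : 1 / (l * q) ≤ 1 / (k * q) := by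
    rw [one_div, one_div, mul_inv, mul_inv]
    gcongr
  simp only [neg_mul]
  gcongr

end MatrixConcentration

theorem theorem3p2 {Ω : Type*} [MeasurableSpace Ω] (P : Measure Ω) [IsProbabilityMeasure P]
    (N : ℕ) (hN : 1 ≤ N)
    -- the deterministic self-adjoint matrix, with entries bounded by `a`
    (A : Matrix (Fin N) (Fin N) ℂ) (hA : A.IsHermitian)
    (a : ℝ) (ha : ∀ i j, ‖A i j‖ ≤ a)
    -- the laws of the real and of the imaginary parts of the entries
    (PR PI : Fin N → Fin N → Measure ℝ)
    (hPR : ∀ i j, i ≤ j → IsProbabilityMeasure (PR i j))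
    (hPI : ∀ i j, i ≤ j → IsProbabilityMeasure (PI i j))
    -- the self-adjoint random array, with independent entries on and above the diagonal
    (ω : Fin N → Fin N → Ω → ℂ)
    (hsa : ∀ i j x, ω i j x = (starRingEnd ℂ) (ω j i x))
    (hlaw : ∀ i j, i ≤ j →
      HasLaw (ω i j) (MatrixConcentration.entryLaw (PR i j) (PI i j)) P)
    (hind : iIndepFun (fun p : {p : Fin N × Fin N // p.1 ≤ p.2} => ω p.1.1 p.1.2) P) :
    -- uniformly compactly supported entries, convex Lipschitz test functions
    (∀ K : Set ℂ, IsCompact K →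
      (∀ i j, i ≤ j → MatrixConcentration.entryLaw (PR i j) (PI i j) Kᶜ = 0) →
      ∀ f : ℝ → ℝ, ConvexOn ℝ Set.univ f → (∃ L, LipschitzWith L f) →
        Integrable (fun x => MatrixConcentration.spectralStat f A (fun i j => ω i j x)) P ∧
        ∀ δ₀ : ℝ,
          δ₀ = 8 * Metric.diam K * Real.sqrt Real.pi * a * MatrixConcentration.lipConst f / N →
          ∀ δ : ℝ, δ₀ < δ →
            P.real {x | δ ≤ ‖MatrixConcentration.spectralStat f A (fun i j => ω i j x) -
                ∫ y, MatrixConcentration.spectralStat f A (fun i j => ω i j y) ∂P‖} ≤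
              4 * Real.exp (-(1 / (16 * Metric.diam K ^ 2 * a ^ 2 *
                MatrixConcentration.lipConst f ^ 2)) * (N : ℝ) ^ 2 * (δ - δ₀) ^ 2)) ∧
    -- entries with a uniform logarithmic Sobolev inequality, Lipschitz test functions
    (∀ c : ℝ,
      (∀ i j, i ≤ j → MatrixConcentration.LogSobolev (PR i j) c ∧
        MatrixConcentration.LogSobolev (PI i j) c) →
      ∀ f : ℝ → ℝ, (∃ L, LipschitzWith L f) →
        Integrable (fun x => MatrixConcentration.spectralStat f A (fun i j => ω i j x)) P ∧
        ∀ δ : ℝ, 0 < δ →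
          P.real {x | δ ≤ ‖MatrixConcentration.spectralStat f A (fun i j => ω i j x) -
              ∫ y, MatrixConcentration.spectralStat f A (fun i j => ω i j y) ∂P‖} ≤
            2 * Real.exp (-(1 / (8 * c * a ^ 2 *
              MatrixConcentration.lipConst f ^ 2)) * (N : ℝ) ^ 2 * δ ^ 2)) := by
  have ha_nonneg : 0 ≤ a := (norm_nonneg _).trans (ha ⟨0, hN⟩ ⟨0, hN⟩)
  have hlaw' (p : MatrixConcentration.UpperIndex N) := hlaw p.1.1 p.1.2 p.2
  have hprob (p : MatrixConcentration.UpperIndex N) := (hlaw' p).isProbabilityMeasure_iff.1 ‹_›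
  refine ⟨fun K hK hPK f hconv ⟨L, hf⟩ => ?_, fun c hc f ⟨L, hf⟩ => ?_⟩
  · obtain ⟨hint, hdev⟩ := MatrixConcentration.spectralStat_deviation_le_of_isBounded hA ha_nonneg
      ha hsa hlaw' hind hK.isBounded (fun p => hPK p.1.1 p.1.2 p.2) hconv hf
    refine ⟨hint, fun δ₀ hδ₀ δ hδ => ?_⟩
    have hlip := MatrixConcentration.lipConst_nonneg f
    have hδ₀_nonneg : 0 ≤ δ₀ := hδ₀ ▸ by positivity
    simp only [mul_assoc (16 : ℝ)]
    refine (hdev δ (hδ₀_nonneg.trans hδ.le)).trans (mul_le_mul (by norm_num) ?_ (by positivity)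
      zero_le_four)
    exact MatrixConcentration.exp_neg_inv_mul_sq_le (by norm_num) (by norm_num) (by positivity)
      (sub_nonneg.2 hδ.le) (sub_le_self δ hδ₀_nonneg) N
  · have hPR' (p : MatrixConcentration.UpperIndex N) := hPR p.1.1 p.1.2 p.2
    have hPI' (p : MatrixConcentration.UpperIndex N) := hPI p.1.1 p.1.2 p.2
    have hLS (p : MatrixConcentration.UpperIndex N) := hc p.1.1 p.1.2 p.2
    lift c to NNReal using (hLS ⟨(⟨0, hN⟩, ⟨0, hN⟩), le_rfl⟩).1.nonneg
    obtain ⟨hint, hdev⟩ := MatrixConcentration.spectralStat_deviation_le_of_expLogSobolev hA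
      ha_nonneg ha hsa hlaw' hind
      (fun p => (hLS p).1.expLogSobolev.entryLaw (hLS p).2.expLogSobolev) hf
    refine ⟨hint, fun δ hδ => (hdev δ hδ.le).trans (mul_le_mul_of_nonneg_left ?_ zero_le_two)⟩
    simp only [mul_assoc (8 : ℝ)]
    exact MatrixConcentration.exp_neg_inv_mul_sq_le (by norm_num) (by norm_num) (by positivity)
      hδ.le le_rfl N
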